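/- **Notation.** All powers and logarithms of $w\in\mathbb C^*\setminus\mathbb R_{<0}$ are principal. For $\Re(\omega_1),\Re(\omega_2)>0$ and $x\in\mathbb C$ let $\zeta_2(s,x\,|\,\omega_1,\omega_2)=\sum_{m,n\ge 0}(x+m\omega_1+n\omega_2)^{-s}$ ($\Re(s)>2$), continued analytically to $s\in\mathbb C\setminus\{1,2\}$, and let $\Gamma_2(x\,|\,\omega_1,\omega_2)=\exp\big(\partial_s\zeta_2(s,x\,|\,\omega_1,\omega_2)|_{s=0}\big)$ be the Barnes double gamma function (with $1/\Gamma_2=0$ at the poles $x=-m\omega_1-n\omega_2$, $m,n\in\mathbb Z_{\ge0}$). Put $$B_{2,2}(x\,|\,\omega_1,\omega_2)=\frac{x^2}{\omega_1\omega_2}-\Big(\frac1{\omega_1}+\frac1{\omega_2}\Big)x+\frac16\Big(\frac{\omega_2}{\omega_1}+\frac{\omega_1}{\omega_2}\Big)+\frac12,$$ $$F(w,\eta\,|\,\omega_1,\omega_2)=\Gamma_2(w+\eta\,|\,\omega_1,\omega_2)\,\exp\!\Big(\tfrac12B_{2,2}(w+\eta\,|\,\omega_1,\omega_2)\log w\Big)\exp\!\Big(-\frac{3w^2}{4\omega_1\omega_2}-\frac{\eta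 w}{\omega_1\omega_2}+\frac{w(\omega_1+\omega_2)}{2\omega_1\omega_2}\Big).$$ With $G$ the Barnes $G$-function and $\zeta$ the Riemann zeta function, put $$\Upsilon(w,\theta)=\frac{e^{-\zeta'(-1)}\,G(w+\theta+1)\,e^{\frac{3w^2}4+\theta w}}{(2\pi)^{\frac12(w+\theta)}\,w^{\frac12(w+\theta)^2-\frac1{12}}},\qquad \Lambda(w,\eta\,|\,1)=\frac{\Gamma(w+\eta)\,e^w}{\sqrt{2\pi}\;w^{\eta+w-\frac12}}.$$ For $z\in\mathbb C^*$ let $\ell_\pm=\pm\mathbb R_{>0}\,z$, and for $t\in\mathbb C^*\setminus i\ell_\pm$ let $$\psi_\pm(t)=\psi_\pm(t)(\tau,\theta)=F\Big(\pm\frac z{2\pi it},\frac{1+\tau}2\mp\theta\,\Big|\,1,\tau\Big)^{-1}$$ be the adjoint-form functions. **Lemma 4.2** ($\tau\to1$ limit). (i) For each choice of sign, all $z\in\mathbb C^*$, $t\in\mathbb C^*\setminus i\ell_\pm$ and $\theta\in\mathbb C$, $$\lim_{\tau\to1}\psi_\pm(t)=F\Big(\pm\frac z{2\pi it},1\mp\theta\,\Big|\,1,1\Big)^{-1}=\Upsilon\Big(\frac{\pm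 z}{2\pi it},\mp\theta\Big).$$ (ii) For $w\in\mathbb C^*\setminus\mathbb R_{<0}$ and $\theta\in\mathbb C$ with $w+\theta\notin\mathbb Z_{\le0}$ one has $\Upsilon(w,\theta-1)\neq0$ and $$\frac{\Upsilon(w,\theta)}{\Upsilon(w,\theta-1)}=\Lambda(w,\theta\,|\,1).$$ (iii) For $w\in\mathbb C^*\setminus\mathbb R_{<0}$, $$w^{-\frac1{12}}\,\Upsilon(w,0)=\frac{e^{-\zeta'(-1)}\,G(w+1)\,e^{\frac{3w^2}4}}{(2\pi)^{\frac w2}\,w^{\frac{w^2}2}}.$$ The right-hand side at $w=\pm z/(2\pi it)$ is the $\tau$-function found in earlier work at $\theta=0$, so that $w^{-1/12}\,\Upsilon(w,\mp\theta)=w^{-1/12}\lim_{\tau\to1}\psi_\pm(t)$ extends it to all values of $\theta$. -/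

import Mathlib

open Filter Topology

namespace QRH

noncomputable section

/-- `Z` is the analytic continuation, in the variable `s`, of the Barnes double zeta function
`ζ₂(s, x | a, b) = ∑_{m, n ≥ 0} (x + m a + n b)^{-s}`: it agrees with the (absolutely convergent)
series for `Re s > 2` and is holomorphic away from the two possible poles `s = 1, 2`.  As
`ℂ ∖ {1, 2}` is connected, such a `Z` is unique there.  Here `Re a > 0`, `Re b > 0`. -/
def IsDoubleZeta (x a b : ℂ) (Z : ℂ → ℂ) : Prop :=
  DifferentiableOn ℂ Z ({1, 2} : Set ℂ)ᶜ ∧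
    ∀ s : ℂ, 2 < s.re → Z s = ∑' p : ℕ × ℕ, (x + p.1 * a + p.2 * b) ^ (-s)

/-- The Barnes double zeta function `s ↦ ζ₂(s, x | a, b)`, analytically continued. -/
def doubleZeta (x a b : ℂ) : ℂ → ℂ :=
  Classical.epsilon (IsDoubleZeta x a b)

open Classical in
/-- The Barnes double gamma function `Γ₂(x | a, b) = exp (∂ζ₂/∂s (0, x | a, b))`, for `Re a > 0`,
`Re b > 0`.  At its poles `x = -(m a + n b)` it is given the value `0` (the convention of
`Complex.Gamma`), so that `(Γ₂(x | a, b))⁻¹` is the entire function `1 / Γ₂` of `x` everywhere. -/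
def doubleGamma (x a b : ℂ) : ℂ :=
  if ∃ m n : ℕ, x + m * a + n * b = 0 then 0
  else Complex.exp (deriv (doubleZeta x a b) 0)

/-- The double Bernoulli polynomial `B_{2,2}(x | a, b)`. -/
def B22 (x a b : ℂ) : ℂ :=
  x ^ 2 / (a * b) - (1 / a + 1 / b) * x + (1 / 6) * (b / a + a / b) + 1 / 2

/-- The modified double gamma function `F(w, η | a, b)`, with the principal branch of `log w`. -/
def F (w η a b : ℂ) : ℂ :=
  doubleGamma (w + η) a b * Complex.exp ((1 / 2) * B22 (w + η) a b * Complex.log w) *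
    Complex.exp (-(3 * w ^ 2) / (4 * a * b) - η * w / (a * b) + w * (a + b) / (2 * a * b))

/-- The variable `w = ± z / (2 π i t)`, where `σ = ±1` is the sign. -/
def wVar (σ z t : ℂ) : ℂ := σ * z / (2 * Real.pi * Complex.I * t)

/-- The adjoint form `ψ_±(t) = F(± z / (2πit), (1 + τ)/2 ∓ θ | 1, τ)⁻¹` of the solution of the
doubled A₁ quantum Riemann–Hilbert problem, as a function of `(τ, θ)`; `σ = ±1` is the sign. -/
def psi (σ z t τ θ : ℂ) : ℂ := (F (wVar σ z t) ((1 + τ) / 2 - σ * θ) 1 τ)⁻¹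

/-- The Barnes `G`-function, by its Weierstrass product
`G(1 + u) = (2π)^{u/2} exp(-(u + (1 + γ) u²)/2) ∏_{k ≥ 1} (1 + u/k)^k exp(u²/(2k) - u)`. -/
def barnesG (x : ℂ) : ℂ :=
  (2 * Real.pi : ℂ) ^ ((x - 1) / 2) *
    Complex.exp (-((x - 1) + (1 + Real.eulerMascheroniConstant) * (x - 1) ^ 2) / 2) *
    ∏' k : ℕ, ((1 + (x - 1) / (k + 1)) ^ (k + 1) *
      Complex.exp ((x - 1) ^ 2 / (2 * (k + 1)) - (x - 1)))

/-- `Υ(w, θ)`, with the principal branch of the power of `w`. -/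
def Upsilon (w θ : ℂ) : ℂ :=
  (Complex.exp (-deriv riemannZeta (-1)) * barnesG (w + θ + 1) *
      Complex.exp (3 * w ^ 2 / 4 + θ * w)) /
    ((2 * Real.pi : ℂ) ^ ((1 / 2) * (w + θ)) * w ^ ((1 / 2) * (w + θ) ^ 2 - 1 / 12))

/-- The modified gamma function `Λ(w, η | 1)`, with the principal branch of the power of `w`. -/
def Lam (w η : ℂ) : ℂ :=
  (Complex.Gamma (w + η) * Complex.exp w) /
    ((Real.sqrt (2 * Real.pi) : ℂ) * w ^ (η + w - 1 / 2))

/-- The `τ`-function of the classical Riemann–Hilbert problem of the doubled A₁ structure at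
`θ = 0`, as a function of `w = ± z / (2 π i t)`. -/
def tauFn (w : ℂ) : ℂ :=
  (Complex.exp (-deriv riemannZeta (-1)) * barnesG (w + 1) * Complex.exp (3 * w ^ 2 / 4)) /
    ((2 * Real.pi : ℂ) ^ (w / 2) * w ^ (w ^ 2 / 2))

end

end QRH

/-!
# The limit `τ → 1` of the adjoint form

Everything reduces to two facts on the reciprocal double gamma function `1 / Γ₂(x | a, b)`: it is
continuous in `(x, b)`, also at its zeros, and for `a = b = 1` it is the Barnes `G`-function up to
elementary factors.

*Continuation and continuity.* Write `y = x + m a + n b`. There is a finite sum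
`P(s, y) = ∑_{j < K} e_j π_j(s) y^{2 - j - s}` (`asympSum`), with `e_j` the Taylor coefficients of
`t² / ((1 - e^{-a t})(1 - e^{-b t}))` and `π_j(s) = (s - 2)(s - 1) s ⋯ (s + j - 3)`, whose mixed second
difference in `y` with steps `a`, `b` is `(s - 2)(s - 1) y^{-s} + O(|y|^{2 - K - Re s})`
(`exists_norm_mixedDiff_asympSum_sub_le`). Mixed differences telescope in the double sum, so they can
be subtracted from the series without changing its value, and what remains converges for
`Re s > 4 - K`. To stay away from the branch cut, `P` is used only at the lattice points with
`m + n ≥ N`, which lie in the right half plane. For growing `K` the results fit together to the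
continuation of `ζ₂`, so that `doubleZeta` really is the continuation (`doubleZeta_eq_div`). For
`K = 5` the derivative at `s = 0` is available: `1 / Γ₂` is the finite product of the `y` with
`m + n < N` times the exponential of a dominated series (`inv_doubleGamma_eq`). Hence it is
continuous (`tendsto_inv_doubleGamma`).

*Equal periods.* For `a = b = 1` and `u = x - 1` the series is `∑_κ κ (κ + u)^{-s}` over `κ ≥ 1`.
Three terms of the binomial expansion give
`ζ(s - 1) - s u ζ(s) + s (s + 1) u² ζ(s + 1) / 2` plus a series that converges for `Re s > -1`, whose
derivative at `0` is termwise minus the logarithm of a factor of the Weierstrass product of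
`G(1 + u)`. As `ζ(0) = -1/2`, and `γ` is the constant term of `ζ` at `1`, the elementary factors
of the Weierstrass product come out as well (`inv_doubleGamma_one_one`).

*The difference relation* follows from `G(x + 1) = Γ(x) G(x)` (`barnesG_add_one`), obtained from the
quotients of partial products by Euler's limit for `Γ`, Stirling's formula and the definition of `γ`.
-/

namespace QRH

/-! ### Mixed differences of complex powers -/

lemma choose_succ (q : ℂ) (i : ℕ) :
    Ring.choose q (i + 1) = Ring.choose q i * (q - i) / (i + 1) := by
  have h1 := Ring.descPochhammer_eq_factorial_smul_choose q (i + 1)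
  have h0 := Ring.descPochhammer_eq_factorial_smul_choose q i
  rw [descPochhammer_succ_right, Polynomial.smeval_mul, h0] at h1
  simp only [Polynomial.smeval_sub, Polynomial.smeval_X, pow_one, Polynomial.smeval_natCast,
    pow_zero, nsmul_eq_mul, mul_one, Nat.factorial_succ, Nat.cast_mul, Nat.cast_add,
    Nat.cast_one] at h1
  have hf : (i.factorial : ℂ) ≠ 0 := by exact_mod_cast i.factorial_ne_zero
  have hi : (i : ℂ) + 1 ≠ 0 := by exact_mod_cast i.succ_ne_zero
  rw [eq_div_iff hi]
  apply mul_left_cancel₀ hf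
  linear_combination -h1

lemma norm_choose_le (q : ℂ) (i : ℕ) : ‖Ring.choose q i‖ ≤ (1 + ‖q‖) ^ i := by
  induction i with
  | zero => simp
  | succ i ih =>
    rw [choose_succ, mul_div_assoc, norm_mul, pow_succ]
    gcongr
    have hi : ‖(i : ℂ) + 1‖ = i + 1 := by
      exact_mod_cast Complex.norm_natCast (i + 1)
    rw [norm_div, hi, div_le_iff₀ (by positivity)]
    calc ‖q - i‖ ≤ ‖q‖ + i := by simpa using norm_sub_le q (i : ℂ)
      _ ≤ (1 + ‖q‖) * (i + 1) := by nlinarith [norm_nonneg q, mul_nonneg (norm_nonneg q) i.cast_nonneg]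

lemma hasSum_choose_mul_pow {v : ℂ} (q : ℂ) (hv : ‖v‖ < 1) :
    HasSum (fun i : ℕ => Ring.choose q i * v ^ i) ((1 + v) ^ q) := by
  have h := (Complex.one_add_cpow_hasFPowerSeriesOnBall_zero (a := q)).hasSum (y := v)
    (by simpa [enorm_eq_nnnorm, ← NNReal.coe_lt_one] using hv)
  simpa [binomialSeries, FormalMultilinearSeries.coeff_ofScalars, mul_comm] using h

/-- Taylor's formula with remainder for the binomial series, with an error that is uniform for
bounded exponents. -/
lemma norm_one_add_cpow_sub_le {v : ℂ} (q : ℂ) {M : ℝ} (hM : 1 + ‖q‖ ≤ M) (hv : M * ‖v‖ ≤ 1 / 2)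
    (I : ℕ) :
    ‖(1 + v) ^ q - ∑ i ∈ Finset.range I, Ring.choose q i * v ^ i‖ ≤ 2 * (M * ‖v‖) ^ I := by
  have hM1 : 1 ≤ M := by linarith [norm_nonneg q]
  have hv1 : ‖v‖ < 1 := by nlinarith [norm_nonneg v]
  have hr : (0 : ℝ) ≤ M * ‖v‖ := by positivity
  have hs := (hasSum_nat_add_iff' I).mpr (hasSum_choose_mul_pow q hv1)
  have hg : HasSum (fun i : ℕ => (M * ‖v‖) ^ I * (M * ‖v‖) ^ i)
      ((M * ‖v‖) ^ I * (1 - M * ‖v‖)⁻¹) :=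
    (hasSum_geometric_of_lt_one hr (by linarith)).mul_left _
  have hle : ‖(1 + v) ^ q - ∑ i ∈ Finset.range I, Ring.choose q i * v ^ i‖ ≤
      (M * ‖v‖) ^ I * (1 - M * ‖v‖)⁻¹ := by
    rw [← hs.tsum_eq]
    refine tsum_of_norm_bounded hg fun i => ?_
    rw [norm_mul, norm_pow, ← pow_add, add_comm I i, mul_pow]
    gcongr
    exact (norm_choose_le q _).trans (by gcongr)
  refine hle.trans ?_
  rw [mul_comm]
  gcongr
  rw [inv_le_comm₀ (by linarith) (by norm_num)]
  linarith

/-- In the right half plane the principal branch is multiplicative for small relative shifts. -/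
lemma add_cpow_eq_mul {y h : ℂ} (q : ℂ) (hy : 0 < y.re) (hh : ‖h‖ < ‖y‖) :
    (y + h) ^ q = y ^ q * (1 + h / y) ^ q := by
  have hy0 : y ≠ 0 := by rintro rfl; simp at hy
  have hv : ‖h / y‖ < 1 := by
    rw [norm_div, div_lt_one (norm_pos_iff.mpr hy0)]; exact hh
  have hre : 0 < (1 + h / y).re := by
    have := (abs_le.mp (Complex.abs_re_le_norm (h / y))).1
    simp only [Complex.add_re, Complex.one_re]; linarith
  have hv0 : 1 + h / y ≠ 0 := by intro h0; rw [h0] at hre; simp at hre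
  have h1 := abs_lt.mp (Complex.abs_arg_lt_pi_div_two_iff.mpr (Or.inl hy))
  have h2 := abs_lt.mp (Complex.abs_arg_lt_pi_div_two_iff.mpr (Or.inl hre))
  have hmul : y + h = y * (1 + h / y) := by field_simp
  have hlog : Complex.log (y * (1 + h / y)) = Complex.log y + Complex.log (1 + h / y) :=
    (Complex.log_mul_eq_add_log_iff hy0 hv0).mpr ⟨by linarith [h1.1, h2.1], by linarith [h1.2, h2.2]⟩
  rw [hmul, Complex.cpow_def_of_ne_zero (mul_ne_zero hy0 hv0), hlog,
    Complex.cpow_def_of_ne_zero hy0, Complex.cpow_def_of_ne_zero hv0, ← Complex.exp_add]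
  ring_nf

lemma norm_add_cpow_sub_le {y h q : ℂ} {M : ℝ} (hM : 1 + ‖q‖ ≤ M) (hy : 0 < y.re)
    (hh : M * ‖h‖ ≤ ‖y‖ / 2) (I : ℕ) :
    ‖(y + h) ^ q - ∑ i ∈ Finset.range I, Ring.choose q i * h ^ i * y ^ (q - i)‖ ≤
      2 * ‖y ^ q‖ * (M * ‖h‖ / ‖y‖) ^ I := by
  have hy0 : y ≠ 0 := by rintro rfl; simp at hy
  have hyn : 0 < ‖y‖ := norm_pos_iff.mpr hy0
  have hM1 : 1 ≤ M := by linarith [norm_nonneg q]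
  have hhy : ‖h‖ < ‖y‖ := by nlinarith [norm_nonneg h]
  have hdiv : M * ‖h / y‖ = M * ‖h‖ / ‖y‖ := by rw [norm_div]; ring
  have key := norm_one_add_cpow_sub_le (v := h / y) q hM
    (by rw [hdiv, div_le_iff₀ hyn]; linarith) I
  have hsum : ∑ i ∈ Finset.range I, Ring.choose q i * h ^ i * y ^ (q - i) =
      y ^ q * ∑ i ∈ Finset.range I, Ring.choose q i * (h / y) ^ i := by
    rw [Finset.mul_sum]
    refine Finset.sum_congr rfl fun i _ => ?_
    rw [Complex.cpow_sub _ _ hy0, Complex.cpow_natCast, div_pow]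
    ring
  rw [hsum, add_cpow_eq_mul q hy hhy, ← mul_sub, norm_mul, ← hdiv]
  calc _ ≤ ‖y ^ q‖ * (2 * (M * ‖h / y‖) ^ I) := by gcongr
    _ = _ := by ring

lemma norm_cpow_le_of_norm_le {y q : ℂ} {ρ : ℝ} (hy : y ≠ 0) (hq : |q.im| ≤ ρ) :
    ‖y ^ q‖ ≤ Real.exp (Real.pi * ρ) * ‖y‖ ^ q.re := by
  rw [Complex.norm_cpow_of_ne_zero hy, div_eq_mul_inv, ← Real.exp_neg, mul_comm]
  gcongr
  calc -(y.arg * q.im) ≤ |y.arg * q.im| := neg_le_abs _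
    _ = |y.arg| * |q.im| := abs_mul _ _
    _ ≤ Real.pi * ρ := by
      gcongr
      exact Complex.abs_arg_le_pi y

/-- The mixed second difference of `f` at `y` with steps `a` and `b`. -/
def mixedDiff (a b : ℂ) (f : ℂ → ℂ) (y : ℂ) : ℂ :=
  f y - f (y + a) - f (y + b) + f (y + (a + b))

/-- The `i`-th Taylor coefficient at `0`, times `i !`, of `(e^{a t} - 1) (e^{b t} - 1)`. -/
def mixedCoeff (a b : ℂ) (i : ℕ) : ℂ := 0 ^ i - a ^ i - b ^ i + (a + b) ^ i

lemma norm_mixedDiff_cpow_sub_le {a b y q : ℂ} {M A : ℝ} (hM : 1 + ‖q‖ ≤ M) (hy : 0 < y.re)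
    (ha : ‖a‖ ≤ A) (hb : ‖b‖ ≤ A) (hA : M * (2 * A) ≤ ‖y‖ / 2) (I : ℕ) :
    ‖mixedDiff a b (fun u => u ^ q) y -
      ∑ i ∈ Finset.range I, Ring.choose q i * mixedCoeff a b i * y ^ (q - i)‖ ≤
      8 * ‖y ^ q‖ * (M * (2 * A) / ‖y‖) ^ I := by
  have hA0 : 0 ≤ A := (norm_nonneg a).trans ha
  have hM1 : 1 ≤ M := by linarith [norm_nonneg q]
  have est : ∀ h : ℂ, ‖h‖ ≤ 2 * A →
      ‖(y + h) ^ q - ∑ i ∈ Finset.range I, Ring.choose q i * h ^ i * y ^ (q - i)‖ ≤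
      2 * ‖y ^ q‖ * (M * (2 * A) / ‖y‖) ^ I := by
    intro h hh
    have h1 : M * ‖h‖ ≤ M * (2 * A) := by gcongr
    refine (norm_add_cpow_sub_le hM hy (h1.trans hA) I).trans ?_
    gcongr
  have e0 := est 0 (by simpa using hA0)
  have ea := est a (by linarith)
  have eb := est b (by linarith)
  have eab := est (a + b) ((norm_add_le _ _).trans (by linarith))
  have hsplit : mixedDiff a b (fun u => u ^ q) y -
      ∑ i ∈ Finset.range I, Ring.choose q i * mixedCoeff a b i * y ^ (q - i) =
      ((y + 0) ^ q - ∑ i ∈ Finset.range I, Ring.choose q i * 0 ^ i * y ^ (q - i)) -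
      ((y + a) ^ q - ∑ i ∈ Finset.range I, Ring.choose q i * a ^ i * y ^ (q - i)) -
      ((y + b) ^ q - ∑ i ∈ Finset.range I, Ring.choose q i * b ^ i * y ^ (q - i)) +
      ((y + (a + b)) ^ q - ∑ i ∈ Finset.range I, Ring.choose q i * (a + b) ^ i * y ^ (q - i)) := by
    have : ∀ i, Ring.choose q i * mixedCoeff a b i * y ^ (q - i) =
        Ring.choose q i * 0 ^ i * y ^ (q - i) - Ring.choose q i * a ^ i * y ^ (q - i) -
        Ring.choose q i * b ^ i * y ^ (q - i) + Ring.choose q i * (a + b) ^ i * y ^ (q - i) := by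
      intro i; unfold mixedCoeff; ring
    simp only [this, Finset.sum_add_distrib, Finset.sum_sub_distrib, mixedDiff, add_zero]
    ring
  rw [hsplit]
  refine (norm_add_le _ _).trans ?_
  have := norm_sub_le ((y + 0) ^ q - ∑ i ∈ Finset.range I, Ring.choose q i * 0 ^ i * y ^ (q - i) -
      ((y + a) ^ q - ∑ i ∈ Finset.range I, Ring.choose q i * a ^ i * y ^ (q - i)))
      ((y + b) ^ q - ∑ i ∈ Finset.range I, Ring.choose q i * b ^ i * y ^ (q - i))
  have := norm_sub_le ((y + 0) ^ q - ∑ i ∈ Finset.range I, Ring.choose q i * 0 ^ i * y ^ (q - i))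
      ((y + a) ^ q - ∑ i ∈ Finset.range I, Ring.choose q i * a ^ i * y ^ (q - i))
  linarith

/-! ### The asymptotic primitive of the summand -/

/-- The Pochhammer-type polynomial `(s - 2)(s - 1) s ⋯ (s + j - 3)` with `j` factors. -/
def pochTwo (s : ℂ) (j : ℕ) : ℂ := ∏ i ∈ Finset.range j, (s - 2 + i)

lemma pochTwo_succ (s : ℂ) (j : ℕ) : pochTwo s (j + 1) = pochTwo s j * (s - 2 + j) :=
  Finset.prod_range_succ _ _

lemma pochTwo_two (s : ℂ) : pochTwo s 2 = (s - 2) * (s - 1) := by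
  simp only [pochTwo, Finset.prod_range_succ, Finset.prod_range_zero]
  push_cast; ring

lemma differentiable_pochTwo (j : ℕ) : Differentiable ℂ (fun s => pochTwo s j) := by
  unfold pochTwo; fun_prop

/-- The binomial coefficient of the exponent of the `j`-th term of `asympSum` shifts `pochTwo s j` to
`pochTwo s (j + i)`; this decouples the coefficients of `asympSum` from `s`. -/
lemma choose_mul_pochTwo (s : ℂ) (j i : ℕ) :
    Ring.choose (2 - j - s) i * pochTwo s j = (-1) ^ i * pochTwo s (j + i) / i.factorial := by
  induction i with
  | zero => simp
  | succ i ih =>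
    have hi : (i : ℂ) + 1 ≠ 0 := by exact_mod_cast i.succ_ne_zero
    have hf : (i.factorial : ℂ) ≠ 0 := by exact_mod_cast i.factorial_ne_zero
    rw [choose_succ, ← add_assoc, pochTwo_succ, Nat.factorial_succ]
    rw [eq_div_iff hf] at ih
    push_cast
    field_simp
    rw [pow_succ]
    linear_combination (2 - s - j - i) * ih

lemma norm_pochTwo_le {s : ℂ} {ρ : ℝ} (hs : ‖s‖ ≤ ρ) {j K : ℕ} (hj : j ≤ K) :
    ‖pochTwo s j‖ ≤ (ρ + 3 + K) ^ K := by
  have hρ : 0 ≤ ρ := (norm_nonneg s).trans hs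
  have h : ‖pochTwo s j‖ ≤ (ρ + 3 + K) ^ j := by
    rw [pochTwo, norm_prod]
    refine (Finset.prod_le_prod (fun _ _ => norm_nonneg _) (g := fun _ => ρ + 3 + (K : ℝ)) ?_).trans
      (by simp)
    intro i hi
    have hi' : (i : ℝ) ≤ K := by
      exact_mod_cast ((Finset.mem_range.mp hi).le.trans hj)
    calc ‖s - 2 + i‖ ≤ ‖s‖ + ‖(2 : ℂ)‖ + ‖(i : ℂ)‖ :=
          (norm_add_le _ _).trans (by gcongr; exact norm_sub_le _ _)
      _ ≤ ρ + 3 + K := by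
        rw [Complex.norm_natCast, Complex.norm_ofNat]; linarith
  refine h.trans (pow_le_pow_right₀ ?_ hj)
  have : (0 : ℝ) ≤ K := K.cast_nonneg
  linarith

/-- The power series `(1 - e^{-a t}) (1 - e^{-b t}) / t²`. -/
noncomputable def todd2Inv (a b : ℂ) : PowerSeries ℂ :=
  PowerSeries.mk fun i => (-1) ^ (i + 2) * mixedCoeff a b (i + 2) / (i + 2).factorial

/-- The coefficients of the power series `t² / ((1 - e^{-a t}) (1 - e^{-b t}))`. -/
noncomputable def todd2 (a b : ℂ) (j : ℕ) : ℂ := PowerSeries.coeff j (todd2Inv a b)⁻¹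

lemma constantCoeff_todd2Inv (a b : ℂ) : PowerSeries.constantCoeff (todd2Inv a b) = a * b := by
  rw [← PowerSeries.coeff_zero_eq_constantCoeff_apply, todd2Inv, PowerSeries.coeff_mk]
  simp [mixedCoeff, Nat.factorial]
  ring

/-- The coefficientwise form of `todd2Inv * todd2Inv⁻¹ = 1`, with indices shifted by two, as
`mixedCoeff a b i` is `i !` times the coefficient of `t ^ i` in `(e^{a t} - 1)(e^{b t} - 1)`. -/
lemma sum_todd2_mul (a b : ℂ) (ha : a ≠ 0) (hb : b ≠ 0) (n : ℕ) :
    ∑ p ∈ Finset.HasAntidiagonal.antidiagonal n,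
      todd2 a b p.1 * ((-1) ^ p.2 * mixedCoeff a b p.2 / (p.2).factorial) =
      if n = 2 then 1 else 0 := by
  have h0 : mixedCoeff a b 0 = 0 := by simp [mixedCoeff]
  have h1 : mixedCoeff a b 1 = 0 := by simp [mixedCoeff]
  have hinv : (todd2Inv a b)⁻¹ * todd2Inv a b = 1 :=
    PowerSeries.inv_mul_cancel _ (by rw [constantCoeff_todd2Inv]; exact mul_ne_zero ha hb)
  match n with
  | 0 => simp [h0]
  | 1 => simp [Finset.Nat.antidiagonal_succ, h0, h1]
  | m + 2 =>
    have hm := congrArg (PowerSeries.coeff m) hinv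
    rw [PowerSeries.coeff_mul, PowerSeries.coeff_one] at hm
    rw [Finset.Nat.antidiagonal_succ', Finset.sum_cons, Finset.sum_map,
      Finset.Nat.antidiagonal_succ', Finset.sum_cons, Finset.sum_map]
    simpa [h0, h1, todd2, todd2Inv] using hm

lemma continuousAt_mixedCoeff (a b : ℂ) (i : ℕ) :
    ContinuousAt (fun b => mixedCoeff a b i) b := by
  unfold mixedCoeff; fun_prop

lemma continuousAt_todd2 {a b : ℂ} (ha : a ≠ 0) (hb : b ≠ 0) (j : ℕ) :
    ContinuousAt (fun b => todd2 a b j) b := by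
  induction j using Nat.strong_induction_on with
  | _ j ih =>
    unfold todd2 at ih ⊢
    simp_rw [PowerSeries.coeff_inv j, constantCoeff_todd2Inv]
    have hc : ContinuousAt (fun b => (a * b)⁻¹) b :=
      (continuousAt_const.mul continuousAt_id).inv₀ (mul_ne_zero ha hb)
    split_ifs with h
    · exact hc
    · refine hc.neg.mul ?_
      refine tendsto_finsetSum _ fun p hp => ?_
      split_ifs with h2
      · refine ContinuousAt.mul ?_ (ih _ h2)
        simp only [todd2Inv, PowerSeries.coeff_mk]
        exact ((continuousAt_const.mul (continuousAt_mixedCoeff a b _))).div_const _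
      · exact tendsto_const_nhds

/-- The polynomial-type expression in `y ^ (2 - s)`, `y ^ (1 - s)`, …, whose mixed second
difference is `(s - 2)(s - 1) y ^ (-s)` up to `O(y ^ (2 - K - s))`. -/
noncomputable def asympSum (a b : ℂ) (K : ℕ) (s y : ℂ) : ℂ :=
  ∑ j ∈ Finset.range K, todd2 a b j * pochTwo s j * y ^ (2 - j - s)

/-- The formal identity behind `asympSum`: all coefficients of the truncated expansion of its mixed
second difference vanish, except the one of `y ^ (-s)`. -/
lemma sum_todd2_choose {a b : ℂ} (ha : a ≠ 0) (hb : b ≠ 0) {K : ℕ} (hK : 3 ≤ K) (s y : ℂ) :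
    ∑ j ∈ Finset.range K, todd2 a b j * pochTwo s j *
      ∑ i ∈ Finset.range (K - j), Ring.choose (2 - j - s) i * mixedCoeff a b i *
        y ^ (2 - j - s - i) = pochTwo s 2 * y ^ (-s) := by
  have hterm : ∀ j i : ℕ, todd2 a b j * pochTwo s j *
      (Ring.choose (2 - j - s) i * mixedCoeff a b i * y ^ (2 - j - s - i)) =
      (todd2 a b j * ((-1) ^ i * mixedCoeff a b i / i.factorial)) *
        (pochTwo s (j + i) * y ^ (2 - ((j + i : ℕ) : ℂ) - s)) := by
    intro j i
    have := choose_mul_pochTwo s j i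
    have he : (2 - j - s - i : ℂ) = 2 - ((j + i : ℕ) : ℂ) - s := by push_cast; ring
    rw [he]
    linear_combination (todd2 a b j * mixedCoeff a b i * y ^ (2 - ((j + i : ℕ) : ℂ) - s)) * this
  simp only [Finset.mul_sum, hterm]
  rw [← Finset.sum_range_diag_flip K (fun j i => (todd2 a b j *
    ((-1) ^ i * mixedCoeff a b i / i.factorial)) *
      (pochTwo s (j + i) * y ^ (2 - ((j + i : ℕ) : ℂ) - s)))]
  have hinner : ∀ n, ∑ k ∈ Finset.range (n + 1), (todd2 a b k *
      ((-1) ^ (n - k) * mixedCoeff a b (n - k) / (n - k).factorial)) *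
      (pochTwo s (k + (n - k)) * y ^ (2 - ((k + (n - k) : ℕ) : ℂ) - s)) =
      if n = 2 then pochTwo s n * y ^ (2 - (n : ℂ) - s) else 0 := by
    intro n
    have h := sum_todd2_mul a b ha hb n
    rw [Finset.Nat.sum_antidiagonal_eq_sum_range_succ (fun j i => todd2 a b j *
      ((-1) ^ i * mixedCoeff a b i / i.factorial))] at h
    rw [← one_mul (pochTwo s n * _), ← zero_mul (pochTwo s n * y ^ (2 - (n : ℂ) - s)),
      ← ite_mul, ← h, Finset.sum_mul]
    refine Finset.sum_congr rfl fun k hk => ?_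
    rw [Nat.add_sub_cancel' (Nat.lt_succ_iff.mp (Finset.mem_range.mp hk))]
  simp only [hinner]
  rw [Finset.sum_ite_eq' (Finset.range K) 2, if_pos (Finset.mem_range.mpr (by omega))]
  congr 2
  push_cast; ring

/-- The mixed second difference of `asympSum` agrees with `(s - 2)(s - 1) y ^ (-s)` up to
`O(y ^ (2 - K - s))`, uniformly for bounded `s`, `a`, `b` and bounded coefficients. -/
lemma exists_norm_mixedDiff_asympSum_sub_le (K : ℕ) (hK : 3 ≤ K) (ρ A E : ℝ) :
    ∃ C R : ℝ, 0 ≤ C ∧ ∀ a b s y : ℂ, a ≠ 0 → b ≠ 0 → ‖s‖ ≤ ρ → ‖a‖ ≤ A → ‖b‖ ≤ A →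
      (∀ j < K, ‖todd2 a b j‖ ≤ E) → 0 < y.re → R ≤ ‖y‖ →
      ‖pochTwo s 2 * y ^ (-s) - mixedDiff a b (asympSum a b K s) y‖ ≤
        C * ‖y‖ ^ (2 - K - s.re) := by
  by_cases hpos : 0 ≤ ρ ∧ 0 ≤ A ∧ 0 ≤ E
  swap
  · refine ⟨0, 0, le_rfl, fun a b s y ha hb hs hA hB hE => ?_⟩
    exact absurd ⟨(norm_nonneg _).trans hs, (norm_nonneg _).trans hA,
      (norm_nonneg _).trans (hE 0 (by omega))⟩ hpos
  obtain ⟨hρ, hA0, hE0⟩ := hpos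
  set M : ℝ := 3 + K + ρ with hMdef
  have hM0 : 0 ≤ M := by positivity
  refine ⟨∑ j ∈ Finset.range K, E * (ρ + 3 + K) ^ K *
    (8 * Real.exp (Real.pi * ρ) * (M * (2 * A)) ^ (K - j)), 2 * (M * (2 * A)), by positivity,
    fun a b s y ha hb hs hA hB hE hy hR => ?_⟩
  have hy0 : y ≠ 0 := by rintro rfl; simp at hy
  have hyn : 0 < ‖y‖ := norm_pos_iff.mpr hy0
  have hmd : mixedDiff a b (asympSum a b K s) y = ∑ j ∈ Finset.range K,
      todd2 a b j * pochTwo s j * mixedDiff a b (fun u => u ^ (2 - j - s)) y := by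
    simp only [mixedDiff, asympSum, mul_add, mul_sub, Finset.sum_add_distrib,
      Finset.sum_sub_distrib]
  rw [hmd, ← sum_todd2_choose ha hb hK, ← Finset.sum_sub_distrib, Finset.sum_mul]
  refine (norm_sum_le _ _).trans (Finset.sum_le_sum fun j hj => ?_)
  have hjK := Finset.mem_range.mp hj
  have hj' : (j : ℝ) ≤ K := by exact_mod_cast hjK.le
  rw [← mul_sub, norm_mul, norm_mul, norm_sub_rev, mul_assoc]
  have hMq : 1 + ‖(2 - j - s : ℂ)‖ ≤ M := by
    have : ‖(2 - j - s : ℂ)‖ ≤ ‖(2 : ℂ)‖ + ‖(j : ℂ)‖ + ‖s‖ :=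
      (norm_sub_le _ _).trans (by gcongr; exact norm_sub_le _ _)
    rw [Complex.norm_natCast, Complex.norm_ofNat] at this
    rw [hMdef]; linarith
  have key := norm_mixedDiff_cpow_sub_le hMq hy hA hB (by linarith) (K - j)
  have hcp : ‖y ^ (2 - j - s : ℂ)‖ ≤ Real.exp (Real.pi * ρ) * ‖y‖ ^ (2 - j - s.re) := by
    have := norm_cpow_le_of_norm_le (q := 2 - j - s) (ρ := ρ) hy0
      (by simpa using (Complex.abs_im_le_norm s).trans hs)
    simpa using this
  calc ‖todd2 a b j‖ * (‖pochTwo s j‖ * _)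
      ≤ E * ((ρ + 3 + K) ^ K * (8 * (Real.exp (Real.pi * ρ) * ‖y‖ ^ (2 - j - s.re)) *
        (M * (2 * A) / ‖y‖) ^ (K - j))) := by
        gcongr
        · exact hE j hjK
        · exact norm_pochTwo_le hs hjK.le
        · exact key.trans (by gcongr)
    _ = _ := by
      have hpow : ‖y‖ ^ (2 - j - s.re) / ‖y‖ ^ (K - j) = ‖y‖ ^ (2 - K - s.re) := by
        rw [← Real.rpow_natCast, ← Real.rpow_sub hyn, Nat.cast_sub hjK.le]
        ring_nf
      rw [← hpow, div_pow]
      ring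

/-! ### Accelerated sums over the lattice -/

/-- Termwise differentiation of a series of holomorphic functions, dominated outside a finite set of
indices. -/
lemma differentiableAt_tsum_and_hasSum_deriv {ι : Type*} {f : ι → ℂ → ℂ} {U : Set ℂ} {w₀ : ℂ}
    {u : ι → ℝ} (hu : Summable u) {S : Set ι} (hS : S.Finite) (hU : IsOpen U) (hw : w₀ ∈ U)
    (hf : ∀ i, DifferentiableOn ℂ (f i) U) (hle : ∀ i ∉ S, ∀ w ∈ U, ‖f i w‖ ≤ u i) :
    DifferentiableAt ℂ (fun w => ∑' i, f i w) w₀ ∧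
      HasSum (fun i => deriv (f i) w₀) (deriv (fun w => ∑' i, f i w) w₀) := by
  classical
  have hev : ∀ᶠ w in 𝓝 w₀, w ∈ U ∧ ∀ i ∈ S, ‖f i w‖ ≤ ‖f i w₀‖ + 1 := by
    refine (hU.eventually_mem hw).and ((eventually_all_finite hS).mpr fun i _ => ?_)
    have hc : ContinuousAt (fun w => ‖f i w‖) w₀ :=
      ((hf i).differentiableAt (hU.mem_nhds hw)).continuousAt.norm
    exact (hc.eventually_lt_const (lt_add_one _)).mono fun w hw => hw.le
  obtain ⟨V, hV, hVo, hwV⟩ := eventually_nhds_iff.mp hev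
  have hu' : Summable fun i => if i ∈ S then ‖f i w₀‖ + 1 else u i := by
    refine hu.congr_cofinite ?_
    filter_upwards [hS.compl_mem_cofinite] with i hi
    rw [if_neg hi]
  have hle' : ∀ i, ∀ w ∈ V, ‖f i w‖ ≤ if i ∈ S then ‖f i w₀‖ + 1 else u i := by
    intro i w hwV
    split_ifs with hi
    · exact (hV w hwV).2 i hi
    · exact hle i hi w (hV w hwV).1
  have hfV : ∀ i, DifferentiableOn ℂ (f i) V := fun i => (hf i).mono fun w hw => (hV w hw).1
  exact ⟨(Complex.differentiableOn_tsum_of_summable_norm hu' hfV hVo hle').differentiableAt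
    (hVo.mem_nhds hwV), Complex.hasSum_deriv_of_summable_norm hu' hfV hVo hle' hwV⟩

/-- Dominated convergence for series, with a bound that holds outside a finite set of indices. -/
lemma tendsto_tsum_of_dominated_off_finite {ι α : Type*} {l : Filter α} {f : α → ι → ℂ}
    {g : ι → ℂ} {u : ι → ℝ} (hu : Summable u) {S : Set ι} (hS : S.Finite)
    (hf : ∀ i, Tendsto (fun t => f t i) l (𝓝 (g i)))
    (hle : ∀ᶠ t in l, ∀ i ∉ S, ‖f t i‖ ≤ u i) :
    Tendsto (fun t => ∑' i, f t i) l (𝓝 (∑' i, g i)) := by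
  classical
  have hu' : Summable fun i => if i ∈ S then ‖g i‖ + 1 else u i := by
    refine hu.congr_cofinite ?_
    filter_upwards [hS.compl_mem_cofinite] with i hi
    rw [if_neg hi]
  have hev : ∀ᶠ t in l, ∀ i ∈ S, ‖f t i‖ ≤ ‖g i‖ + 1 :=
    (eventually_all_finite hS).mpr fun i _ =>
      ((hf i).norm.eventually_lt_const (lt_add_one _)).mono fun w hw => hw.le
  refine tendsto_tsum_of_dominated_convergence hu' hf ?_
  filter_upwards [hle, hev] with t h1 h2 i
  split_ifs with hi
  · exact h2 i hi
  · exact h1 i hi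

lemma summable_add_add_one_rpow {r : ℝ} (hr : r < -2) :
    Summable fun p : ℕ × ℕ => ((p.1 : ℝ) + p.2 + 1) ^ r := by
  -- `(m + 1) (n + 1) ≤ (m + n + 1)²` separates the two indices
  have h1 : Summable fun n : ℕ => ((n : ℝ) + 1) ^ (r / 2) := by
    have := (summable_nat_add_iff 1).mpr
      (Real.summable_nat_rpow.mpr (show r / 2 < -1 by linarith))
    simpa using this
  refine (h1.mul_of_nonneg h1 (fun _ => by positivity) (fun _ => by positivity)).of_nonneg_of_le
    (fun p => by positivity) fun p => ?_
  have hp : (0 : ℝ) ≤ p.1 := p.1.cast_nonneg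
  have hq : (0 : ℝ) ≤ p.2 := p.2.cast_nonneg
  rw [← Real.mul_rpow (by positivity) (by positivity)]
  have h2 : ((p.1 : ℝ) + p.2 + 1) ^ r = (((p.1 : ℝ) + p.2 + 1) ^ (2 : ℝ)) ^ (r / 2) := by
    rw [← Real.rpow_mul (by positivity)]; ring_nf
  rw [h2]
  refine Real.rpow_le_rpow_of_nonpos (by positivity) ?_ (by linarith)
  rw [Real.rpow_two]
  nlinarith [mul_nonneg hp hq]

lemma finite_setOf_add_lt (N : ℕ) : {p : ℕ × ℕ | ¬ N ≤ p.1 + p.2}.Finite := by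
  refine ((Set.finite_Iio N).prod (Set.finite_Iio N)).subset fun p hp => ?_
  simp only [Set.mem_ofPred_eq, not_le] at hp
  exact ⟨by simp only [Set.mem_Iio]; omega, by simp only [Set.mem_Iio]; omega⟩

/-- The lattice point `x + m a + n b`. -/
def latticePt (x a b : ℂ) (p : ℕ × ℕ) : ℂ := x + p.1 * a + p.2 * b

/-- Outside the triangle `m + n < N`, the lattice points `x + m a + n b` lie in the right half
plane, with real part at least `c (m + n + 1)`. -/
def TailBound (x a b : ℂ) (N : ℕ) (c : ℝ) : Prop :=
  ∀ p : ℕ × ℕ, N ≤ p.1 + p.2 → c * (p.1 + p.2 + 1) ≤ (latticePt x a b p).re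

lemma tailBound_of_le_re {x a b : ℂ} {α r : ℝ} {N : ℕ} (hα : 0 < α) (ha : α ≤ a.re)
    (hb : α ≤ b.re) (hx : r ≤ x.re) (hN : 1 - 2 * r / α ≤ N) : TailBound x a b N (α / 2) := by
  intro p hp
  have hN' : α - 2 * r ≤ N * α := by
    have := mul_le_mul_of_nonneg_right hN hα.le
    rwa [sub_mul, one_mul, div_mul_cancel₀ _ hα.ne'] at this
  have hp' : (N : ℝ) ≤ p.1 + p.2 := by exact_mod_cast hp
  have h1 : (p.1 : ℝ) * α ≤ p.1 * a.re := by gcongr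
  have h2 : (p.2 : ℝ) * α ≤ p.2 * b.re := by gcongr
  have h3 : (N : ℝ) * α ≤ (p.1 + p.2) * α := by gcongr
  simp only [latticePt, Complex.add_re, Complex.mul_re, Complex.natCast_re, Complex.natCast_im,
    zero_mul, sub_zero]
  linarith

lemma exists_tailBound (x : ℂ) {a b : ℂ} (ha : 0 < a.re) (hb : 0 < b.re) :
    ∃ (N : ℕ) (c : ℝ), 1 ≤ N ∧ 0 < c ∧ TailBound x a b N c := by
  have hα : 0 < min a.re b.re := lt_min ha hb
  obtain ⟨N, hN⟩ := exists_nat_ge (1 - 2 * x.re / min a.re b.re)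
  refine ⟨N + 1, _, by omega, half_pos hα,
    tailBound_of_le_re hα (min_le_left _ _) (min_le_right _ _) le_rfl ?_⟩
  push_cast; linarith

lemma TailBound.re_pos {x a b : ℂ} {N : ℕ} {c : ℝ} (h : TailBound x a b N c) (hc : 0 < c)
    {p : ℕ × ℕ} (hp : N ≤ p.1 + p.2) : 0 < (latticePt x a b p).re :=
  lt_of_lt_of_le (by positivity) (h p hp)

lemma TailBound.ne_zero {x a b : ℂ} {N : ℕ} {c : ℝ} (h : TailBound x a b N c) (hc : 0 < c)
    {p : ℕ × ℕ} (hp : N ≤ p.1 + p.2) : latticePt x a b p ≠ 0 := by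
  intro h0
  have := h.re_pos hc hp
  simp [h0] at this

lemma TailBound.le_norm {x a b : ℂ} {N : ℕ} {c : ℝ} (h : TailBound x a b N c)
    {p : ℕ × ℕ} (hp : N ≤ p.1 + p.2) : c * (p.1 + p.2 + 1) ≤ ‖latticePt x a b p‖ :=
  (h p hp).trans (Complex.re_le_norm _)

/-- The mixed second difference of a function on `ℕ × ℕ`. -/
def gridDiff (u : ℕ × ℕ → ℂ) (p : ℕ × ℕ) : ℂ :=
  u p - u (p.1 + 1, p.2) - u (p.1, p.2 + 1) + u (p.1 + 1, p.2 + 1)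

lemma sum_gridDiff (u : ℕ × ℕ → ℂ) (M : ℕ) :
    ∑ p ∈ Finset.range M ×ˢ Finset.range M, gridDiff u p =
      u (0, 0) - u (M, 0) - u (0, M) + u (M, M) := by
  rw [Finset.sum_product]
  have h1 : ∀ m, ∑ n ∈ Finset.range M, gridDiff u (m, n) =
      (u (m, 0) - u (m, M)) - (u (m + 1, 0) - u (m + 1, M)) := by
    intro m
    rw [← Finset.sum_range_sub' (fun n => u (m, n)) M,
      ← Finset.sum_range_sub' (fun n => u (m + 1, n)) M, ← Finset.sum_sub_distrib]
    refine Finset.sum_congr rfl fun n _ => ?_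
    simp only [gridDiff]; ring
  simp only [h1]
  rw [Finset.sum_range_sub' (fun m => u (m, 0) - u (m, M)) M]
  ring

lemma tendsto_range_product_range :
    Tendsto (fun M : ℕ => Finset.range M ×ˢ Finset.range M) atTop atTop := by
  refine tendsto_atTop_finset_of_monotone
    (fun i j hij => Finset.product_subset_product (Finset.range_mono hij) (Finset.range_mono hij))
    fun p => ⟨p.1 + p.2 + 1, ?_⟩
  simp only [Finset.mem_product, Finset.mem_range]
  omega

/-- `asympSum` at the lattice points outside the triangle `m + n < N`, and `0` inside. -/
noncomputable def tailAsymp (x a b : ℂ) (K N : ℕ) (s : ℂ) (p : ℕ × ℕ) : ℂ :=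
  if N ≤ p.1 + p.2 then asympSum a b K s (latticePt x a b p) else 0

/-- The general term of the series that continues `(s - 2)(s - 1) ∑_{m + n ≥ N} (x + m a + n b)^{-s}`
to `Re s > 4 - K`: subtracting the difference `gridDiff` does not change the sum of the
series for `Re s > 2`, and makes the terms small. -/
noncomputable def tailTerm (x a b : ℂ) (K N : ℕ) (s : ℂ) (p : ℕ × ℕ) : ℂ :=
  (if N ≤ p.1 + p.2 then pochTwo s 2 * latticePt x a b p ^ (-s) else 0) -
    gridDiff (tailAsymp x a b K N s) p

lemma tailTerm_eq {x a b : ℂ} {K N : ℕ} {s : ℂ} {p : ℕ × ℕ} (hp : N ≤ p.1 + p.2) :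
    tailTerm x a b K N s p = pochTwo s 2 * latticePt x a b p ^ (-s) -
      mixedDiff a b (asympSum a b K s) (latticePt x a b p) := by
  have h1 : N ≤ p.1 + 1 + p.2 := by omega
  have h2 : N ≤ p.1 + (p.2 + 1) := by omega
  have h3 : N ≤ p.1 + 1 + (p.2 + 1) := by omega
  have e1 : latticePt x a b (p.1 + 1, p.2) = latticePt x a b p + a := by
    simp only [latticePt]; push_cast; ring
  have e2 : latticePt x a b (p.1, p.2 + 1) = latticePt x a b p + b := by
    simp only [latticePt]; push_cast; ring
  have e3 : latticePt x a b (p.1 + 1, p.2 + 1) = latticePt x a b p + (a + b) := by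
    simp only [latticePt]; push_cast; ring
  simp only [tailTerm, gridDiff, tailAsymp, if_pos hp, if_pos h1, if_pos h2, if_pos h3, e1, e2, e3,
    mixedDiff]

/-- The terms `tailTerm` are dominated, outside a finite set of indices, uniformly for bounded
parameters on a half plane `Re s ≥ σ`. -/
lemma exists_norm_tailTerm_le {K : ℕ} (hK : 3 ≤ K) (N : ℕ) (ρ A E : ℝ) {c σ : ℝ} (hc : 0 < c)
    (hσ : 2 - K - σ ≤ 0) :
    ∃ (C : ℝ) (N' : ℕ), N ≤ N' ∧ ∀ x a b s : ℂ, TailBound x a b N c → a ≠ 0 → b ≠ 0 → ‖s‖ ≤ ρ →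
      ‖a‖ ≤ A → ‖b‖ ≤ A → (∀ j < K, ‖todd2 a b j‖ ≤ E) → σ ≤ s.re → ∀ p : ℕ × ℕ,
      N' ≤ p.1 + p.2 → ‖tailTerm x a b K N s p‖ ≤ C * ((p.1 : ℝ) + p.2 + 1) ^ (2 - K - σ) := by
  obtain ⟨C, R, hC, hb⟩ := exists_norm_mixedDiff_asympSum_sub_le K hK ρ A E
  obtain ⟨N', hN'⟩ := exists_nat_ge (max R 1 / c)
  refine ⟨C * c ^ (2 - K - σ), max N N', le_max_left _ _,
    fun x a b s hT ha0 hb0 hs ha hb' hE hσs p hp => ?_⟩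
  have hpN : N ≤ p.1 + p.2 := (le_max_left _ _).trans hp
  have hpN' : (N' : ℝ) ≤ p.1 + p.2 := by exact_mod_cast (le_max_right _ _).trans hp
  have hbig : max R 1 ≤ c * (p.1 + p.2 + 1) := by
    rw [div_le_iff₀ hc] at hN'
    nlinarith
  have hyn := hT.le_norm hpN
  have h1 : 1 ≤ ‖latticePt x a b p‖ := (le_max_right _ _).trans (hbig.trans hyn)
  rw [tailTerm_eq hpN]
  calc _ ≤ C * ‖latticePt x a b p‖ ^ (2 - K - s.re) :=
        hb a b s _ ha0 hb0 hs ha hb' hE (hT.re_pos hc hpN)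
          ((le_max_left _ _).trans (hbig.trans hyn))
    _ ≤ C * ‖latticePt x a b p‖ ^ (2 - K - σ) := by
        gcongr
    _ ≤ C * (c * (p.1 + p.2 + 1)) ^ (2 - K - σ) := by
        gcongr ?_ * ?_
        exact Real.rpow_le_rpow_of_nonpos (by positivity) hyn hσ
    _ = _ := by rw [Real.mul_rpow hc.le (by positivity)]; ring

lemma differentiable_tailAsymp {x a b : ℂ} {N : ℕ} {c : ℝ} (hT : TailBound x a b N c) (hc : 0 < c)
    (K : ℕ) (p : ℕ × ℕ) : Differentiable ℂ fun s => tailAsymp x a b K N s p := by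
  unfold tailAsymp
  split_ifs with hp
  · have h0 := hT.ne_zero hc hp
    unfold asympSum
    refine Differentiable.fun_sum fun _ _ => ?_
    refine ((differentiable_pochTwo _).const_mul _).mul ?_
    exact Differentiable.const_cpow (by fun_prop) (Or.inl h0)
  · fun_prop

lemma differentiable_tailTerm {x a b : ℂ} {N : ℕ} {c : ℝ} (hT : TailBound x a b N c) (hc : 0 < c)
    (K : ℕ) (p : ℕ × ℕ) : Differentiable ℂ fun s => tailTerm x a b K N s p := by
  unfold tailTerm gridDiff
  have h := differentiable_tailAsymp hT hc K
  refine Differentiable.sub ?_ ((((h _).sub (h _)).sub (h _)).add (h _))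
  split_ifs with hp
  · exact (differentiable_pochTwo 2).mul
      (Differentiable.const_cpow (by fun_prop) (Or.inl (hT.ne_zero hc hp)))
  · fun_prop

lemma exists_todd2_le (a b : ℂ) (K : ℕ) : ∃ E, ∀ j < K, ‖todd2 a b j‖ ≤ E :=
  ⟨∑ j ∈ Finset.range K, ‖todd2 a b j‖, fun _ hj =>
    Finset.single_le_sum (f := fun j => ‖todd2 a b j‖) (fun _ _ => norm_nonneg _)
      (Finset.mem_range.mpr hj)⟩

lemma differentiableAt_tsum_tailTerm {x a b : ℂ} {N : ℕ} {c : ℝ} (hT : TailBound x a b N c)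
    (hc : 0 < c) (ha : a ≠ 0) (hb : b ≠ 0) {K : ℕ} (hK : 3 ≤ K) {s : ℂ} (hs : 4 - K < s.re) :
    DifferentiableAt ℂ (fun s => ∑' p, tailTerm x a b K N s p) s ∧
      HasSum (fun p => deriv (fun s => tailTerm x a b K N s p) s)
        (deriv (fun s => ∑' p, tailTerm x a b K N s p) s) := by
  obtain ⟨σ, hσ, hσs⟩ := exists_between hs
  obtain ⟨E, hE⟩ := exists_todd2_le a b K
  obtain ⟨C, N', hN', h⟩ := exists_norm_tailTerm_le hK N (‖s‖ + 1) (max ‖a‖ ‖b‖) E hc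
    (σ := σ) (by linarith)
  refine differentiableAt_tsum_and_hasSum_deriv
    (u := fun p => C * ((p.1 : ℝ) + p.2 + 1) ^ (2 - K - σ))
    (U := {w | σ < w.re} ∩ Metric.ball 0 (‖s‖ + 1))
    ((summable_add_add_one_rpow (by linarith)).mul_left C) (finite_setOf_add_lt N')
    ((isOpen_lt continuous_const Complex.continuous_re).inter Metric.isOpen_ball)
    ⟨hσs, by simp⟩ (fun p => (differentiable_tailTerm hT hc K p).differentiableOn) ?_
  intro p hp w hw
  exact h x a b w hT ha hb (mem_ball_zero_iff.mp hw.2).le (le_max_left _ _) (le_max_right _ _) hE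
    hw.1.le p (not_not.mp hp)

lemma summable_tailTerm {x a b : ℂ} {N : ℕ} {c : ℝ} (hT : TailBound x a b N c)
    (hc : 0 < c) (ha : a ≠ 0) (hb : b ≠ 0) {K : ℕ} (hK : 3 ≤ K) {s : ℂ} (hs : 4 - K < s.re) :
    Summable fun p => tailTerm x a b K N s p := by
  obtain ⟨E, hE⟩ := exists_todd2_le a b K
  obtain ⟨C, N', hN', h⟩ := exists_norm_tailTerm_le hK N ‖s‖ (max ‖a‖ ‖b‖) E hc
    (σ := s.re) (by linarith)
  refine Summable.of_norm_bounded_eventually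
    ((summable_add_add_one_rpow (r := 2 - K - s.re) (by linarith)).mul_left C) ?_
  filter_upwards [(finite_setOf_add_lt N').compl_mem_cofinite] with p hp
  exact h x a b s hT ha hb le_rfl (le_max_left _ _) (le_max_right _ _) hE
    le_rfl p (not_not.mp hp)

lemma summable_tail_cpow {x a b : ℂ} {N : ℕ} {c : ℝ} (hT : TailBound x a b N c)
    (hc : 0 < c) {s : ℂ} (hs : 2 < s.re) :
    Summable fun p : ℕ × ℕ => if N ≤ p.1 + p.2 then latticePt x a b p ^ (-s) else 0 := by
  refine Summable.of_norm_bounded (((summable_add_add_one_rpow (r := -s.re) (by linarith)).mul_left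
    (Real.exp (Real.pi * |s.im|) * c ^ (-s.re)))) fun p => ?_
  split_ifs with hp
  · calc ‖latticePt x a b p ^ (-s)‖ ≤ Real.exp (Real.pi * |s.im|) *
          ‖latticePt x a b p‖ ^ (-s).re :=
          norm_cpow_le_of_norm_le (hT.ne_zero hc hp) (by simp)
      _ ≤ Real.exp (Real.pi * |s.im|) * (c * (p.1 + p.2 + 1)) ^ (-s.re) := by
          gcongr ?_ * ?_
          rw [Complex.neg_re]
          exact Real.rpow_le_rpow_of_nonpos (by positivity) (hT.le_norm hp) (by linarith)
      _ = _ := by rw [Real.mul_rpow hc.le (by positivity)]; ring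
  · rw [norm_zero]; positivity

lemma tendsto_tailAsymp {x a b : ℂ} {N : ℕ} {c : ℝ} (hT : TailBound x a b N c)
    (hc : 0 < c) (K : ℕ) {s : ℂ} (hs : 2 < s.re) {q : ℕ → ℕ × ℕ}
    (hq : ∀ M, M ≤ (q M).1 + (q M).2) :
    Tendsto (fun M => tailAsymp x a b K N s (q M)) atTop (𝓝 0) := by
  have hy : Tendsto (fun M => ‖latticePt x a b (q M)‖) atTop atTop := by
    refine tendsto_atTop_mono' _ ?_ ((tendsto_natCast_atTop_atTop (R := ℝ)).const_mul_atTop hc)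
    filter_upwards [eventually_ge_atTop N] with M hM
    refine le_trans ?_ (hT.le_norm (hM.trans (hq M)))
    have : (M : ℝ) ≤ (q M).1 + (q M).2 := by exact_mod_cast hq M
    gcongr; linarith
  have hterm : ∀ j : ℕ, Tendsto (fun M => latticePt x a b (q M) ^ (2 - j - s)) atTop (𝓝 0) := by
    intro j
    have hre : (2 - j - s.re : ℝ) < 0 := by
      have : (0 : ℝ) ≤ j := j.cast_nonneg
      linarith
    have h0 : Tendsto (fun M => Real.exp (Real.pi * |s.im|) *
        ‖latticePt x a b (q M)‖ ^ (2 - j - s.re)) atTop (𝓝 0) := by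
      have := ((tendsto_rpow_neg_atTop (neg_pos.mpr hre)).comp hy).const_mul
        (Real.exp (Real.pi * |s.im|))
      simpa using this
    refine squeeze_zero_norm' ?_ h0
    filter_upwards [eventually_ge_atTop N] with M hM
    have := norm_cpow_le_of_norm_le (q := 2 - j - s) (ρ := |s.im|)
      (hT.ne_zero hc (hM.trans (hq M))) (by simp)
    simpa using this
  have hsum : Tendsto (fun M => asympSum a b K s (latticePt x a b (q M))) atTop (𝓝 0) := by
    have := tendsto_finsetSum (Finset.range K)
      fun j _ => (hterm j).const_mul (todd2 a b j * pochTwo s j)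
    simpa [asympSum] using this
  refine hsum.congr' ?_
  filter_upwards [eventually_ge_atTop N] with M hM
  rw [tailAsymp, if_pos (hM.trans (hq M))]

/-- For `Re s > 2` the mixed differences telescope to the value at the corner `(0, 0)`, which vanishes
as `N ≥ 1`, and to values at infinity, which vanish in the limit. -/
lemma tsum_tailTerm {x a b : ℂ} {N : ℕ} {c : ℝ} (hT : TailBound x a b N c)
    (hc : 0 < c) (hN : 1 ≤ N) (ha : a ≠ 0) (hb : b ≠ 0) {K : ℕ} (hK : 3 ≤ K) {s : ℂ}
    (hs : 2 < s.re) :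
    ∑' p, tailTerm x a b K N s p =
      pochTwo s 2 * ∑' p : ℕ × ℕ, if N ≤ p.1 + p.2 then latticePt x a b p ^ (-s) else 0 := by
  have hK' : (3 : ℝ) ≤ K := by exact_mod_cast hK
  have h1 := summable_tailTerm hT hc ha hb hK (s := s) (by linarith)
  have h2 := (summable_tail_cpow hT hc hs).mul_left (pochTwo s 2)
  have hgd : gridDiff (tailAsymp x a b K N s) = fun p =>
      pochTwo s 2 * (if N ≤ p.1 + p.2 then latticePt x a b p ^ (-s) else 0) -
        tailTerm x a b K N s p := by
    funext p
    simp only [tailTerm, mul_ite, mul_zero]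
    ring
  have h3 := h2.hasSum.sub h1.hasSum
  rw [← hgd] at h3
  have h4 := h3.comp tendsto_range_product_range
  have h00 : tailAsymp x a b K N s (0, 0) = 0 := by
    simp only [tailAsymp]; rw [if_neg (by omega)]
  have h5 : Tendsto (fun M => ∑ p ∈ Finset.range M ×ˢ Finset.range M,
      gridDiff (tailAsymp x a b K N s) p) atTop (𝓝 0) := by
    simp only [sum_gridDiff, h00]
    have t1 := tendsto_tailAsymp hT hc K hs (q := fun M => (M, 0)) (by simp)
    have t2 := tendsto_tailAsymp hT hc K hs (q := fun M => (0, M)) (by simp)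
    have t3 := tendsto_tailAsymp hT hc K hs (q := fun M => (M, M)) (by simp)
    simpa using ((t1.const_sub 0).sub t2).add t3
  have h6 := tendsto_nhds_unique h4 h5
  rw [tsum_mul_left] at h6
  exact (sub_eq_zero.mp h6).symm

/-! ### Analytic continuation of the double zeta function -/

/-- Two holomorphic functions on a half plane that agree for `Re s > 2` are equal. -/
lemma eq_of_eq_of_two_lt_re {f g : ℂ → ℂ} {r : ℝ} (hf : DifferentiableOn ℂ f {s | r < s.re})
    (hg : DifferentiableOn ℂ g {s | r < s.re}) (h : ∀ s : ℂ, 2 < s.re → f s = g s) {s : ℂ}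
    (hs : r < s.re) : f s = g s := by
  have ho : IsOpen {s : ℂ | r < s.re} := isOpen_lt continuous_const Complex.continuous_re
  have hz : r < (((max r 2 + 1 : ℝ) : ℂ)).re := by
    rw [Complex.ofReal_re]; linarith [le_max_left r 2]
  refine (hf.analyticOnNhd ho).eqOn_of_preconnected_of_eventuallyEq (hg.analyticOnNhd ho)
    (convex_halfSpace_re_gt r).isPreconnected hz ?_ hs
  have h2 : {s : ℂ | 2 < s.re} ∈ 𝓝 (((max r 2 + 1 : ℝ) : ℂ)) := by
    refine (isOpen_lt continuous_const Complex.continuous_re).mem_nhds ?_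
    show 2 < (((max r 2 + 1 : ℝ) : ℂ)).re
    rw [Complex.ofReal_re]; linarith [le_max_right r 2]
  filter_upwards [h2] with w hw using h w hw

/-- The lattice indices `(m, n)` with `m + n < N`. -/
def headIndices (N : ℕ) : Finset (ℕ × ℕ) :=
  (Finset.range N ×ˢ Finset.range N).filter fun p => p.1 + p.2 < N

lemma mem_headIndices {N : ℕ} {p : ℕ × ℕ} : p ∈ headIndices N ↔ p.1 + p.2 < N := by
  simp only [headIndices, Finset.mem_filter, Finset.mem_product, Finset.mem_range]
  omega

/-- The analytic continuation of `(s - 2)(s - 1) ∑ (x + m a + n b)^{-s}` to `Re s > 4 - K`. -/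
noncomputable def zetaCont (x a b : ℂ) (K N : ℕ) (s : ℂ) : ℂ :=
  pochTwo s 2 * ∑ p ∈ headIndices N, latticePt x a b p ^ (-s) + ∑' p, tailTerm x a b K N s p

/-- For `Re s > 2` the continuation is `(s - 2)(s - 1)` times the Barnes series. -/
lemma zetaCont_eq {x a b : ℂ} {N : ℕ} {c : ℝ} (hT : TailBound x a b N c)
    (hc : 0 < c) (hN : 1 ≤ N) (ha : a ≠ 0) (hb : b ≠ 0) {K : ℕ} (hK : 3 ≤ K) {s : ℂ}
    (hs : 2 < s.re) :
    zetaCont x a b K N s = pochTwo s 2 * ∑' p : ℕ × ℕ, latticePt x a b p ^ (-s) := by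
  classical
  rw [zetaCont, tsum_tailTerm hT hc hN ha hb hK hs, ← mul_add]
  congr 1
  have h1 : Summable fun p : ℕ × ℕ => if p ∈ headIndices N then latticePt x a b p ^ (-s) else 0 :=
    summable_of_ne_finset_zero (s := headIndices N) fun p hp => if_neg hp
  have h2 : ∑ p ∈ headIndices N, latticePt x a b p ^ (-s) =
      ∑' p : ℕ × ℕ, if p ∈ headIndices N then latticePt x a b p ^ (-s) else 0 := by
    rw [tsum_eq_sum (s := headIndices N) fun p hp => if_neg hp]
    exact Finset.sum_congr rfl fun p hp => (if_pos hp).symm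
  rw [h2, ← h1.tsum_add (summable_tail_cpow hT hc hs)]
  refine tsum_congr fun p => ?_
  by_cases hp : p.1 + p.2 < N
  · rw [if_pos (mem_headIndices.mpr hp), if_neg (by omega), add_zero]
  · rw [if_neg (fun h => hp (mem_headIndices.mp h)), if_pos (by omega), zero_add]

lemma differentiableAt_zetaCont {x a b : ℂ} {N : ℕ} {c : ℝ} (hT : TailBound x a b N c)
    (hc : 0 < c) (hx : ∀ p, latticePt x a b p ≠ 0) (ha : a ≠ 0) (hb : b ≠ 0) {K : ℕ} (hK : 3 ≤ K)
    {s : ℂ} (hs : 4 - K < s.re) : DifferentiableAt ℂ (zetaCont x a b K N) s := by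
  unfold zetaCont
  refine DifferentiableAt.add ((differentiable_pochTwo 2 s).mul ?_)
    (differentiableAt_tsum_tailTerm hT hc ha hb hK hs).1
  refine DifferentiableAt.fun_sum fun p _ => ?_
  exact DifferentiableAt.const_cpow (by fun_prop) (Or.inl (hx p))

/-- The continuations for the different orders `K` fit together. -/
lemma exists_differentiable_zetaCont {x a b : ℂ} {N : ℕ} {c : ℝ} (hT : TailBound x a b N c)
    (hc : 0 < c) (hN : 1 ≤ N) (hx : ∀ p, latticePt x a b p ≠ 0) (ha : a ≠ 0) (hb : b ≠ 0) :
    ∃ V : ℂ → ℂ, Differentiable ℂ V ∧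
      ∀ s : ℂ, 2 < s.re → V s = pochTwo s 2 * ∑' p : ℕ × ℕ, latticePt x a b p ^ (-s) := by
  have hdiff : ∀ K : ℕ, 3 ≤ K →
      DifferentiableOn ℂ (zetaCont x a b K N) {s | (4 - K : ℝ) < s.re} := fun K hK s hs =>
    (differentiableAt_zetaCont hT hc hx ha hb hK hs).differentiableWithinAt
  have hagree : ∀ K L : ℕ, 3 ≤ K → K ≤ L → ∀ s : ℂ, (4 - K : ℝ) < s.re →
      zetaCont x a b K N s = zetaCont x a b L N s := by
    intro K L hK hKL s hs
    have hKL' : (K : ℝ) ≤ L := by exact_mod_cast hKL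
    refine eq_of_eq_of_two_lt_re (hdiff K hK) ((hdiff L (hK.trans hKL)).mono fun w hw => ?_)
      (fun w hw => ?_) hs
    · have hw' : (4 - K : ℝ) < w.re := hw
      show (4 - L : ℝ) < w.re
      linarith
    · rw [zetaCont_eq hT hc hN ha hb hK hw, zetaCont_eq hT hc hN ha hb (hK.trans hKL) hw]
  have hagree' : ∀ K L : ℕ, 3 ≤ K → 3 ≤ L → ∀ s : ℂ, (4 - K : ℝ) < s.re → (4 - L : ℝ) < s.re →
      zetaCont x a b K N s = zetaCont x a b L N s := by
    intro K L hK hL s h1 h2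
    rcases le_total K L with h | h
    · exact hagree K L hK h s h1
    · exact (hagree L K hL h s h2).symm
  have hord : ∀ s : ℂ, (4 - ((⌈5 - s.re⌉₊ + 3 : ℕ) : ℝ)) < s.re := by
    intro s
    have := Nat.le_ceil (5 - s.re)
    push_cast; linarith
  -- at each `s` use an order `K` large enough for the continuation of that order to be defined there
  refine ⟨fun s => zetaCont x a b (⌈5 - s.re⌉₊ + 3) N s, fun s => ?_, fun s hs =>
    zetaCont_eq hT hc hN ha hb (by omega) hs⟩
  have hev : (fun w => zetaCont x a b (⌈5 - w.re⌉₊ + 3) N w) =ᶠ[𝓝 s]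
      zetaCont x a b (⌈5 - s.re⌉₊ + 3) N := by
    have ho : {w : ℂ | (4 - ((⌈5 - s.re⌉₊ + 3 : ℕ) : ℝ)) < w.re} ∈ 𝓝 s :=
      (isOpen_lt continuous_const Complex.continuous_re).mem_nhds (hord s)
    filter_upwards [ho] with w hw
    exact hagree' _ _ (by omega) (by omega) w (hord w) hw
  exact (differentiableAt_zetaCont hT hc hx ha hb (by omega) (hord s)).congr_of_eventuallyEq hev

lemma pochTwo_two_ne_zero {s : ℂ} (hs : s ∈ ({1, 2} : Set ℂ)ᶜ) : pochTwo s 2 ≠ 0 := by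
  simp only [Set.mem_compl_iff, Set.mem_insert_iff, Set.mem_singleton_iff, not_or] at hs
  rw [pochTwo_two]
  exact mul_ne_zero (sub_ne_zero.mpr hs.2) (sub_ne_zero.mpr hs.1)

lemma mem_compl_of_two_lt_re {s : ℂ} (hs : 2 < s.re) : s ∈ ({1, 2} : Set ℂ)ᶜ := by
  simp only [Set.mem_compl_iff, Set.mem_insert_iff, Set.mem_singleton_iff, not_or]
  constructor <;> rintro rfl
  · norm_num at hs
  · norm_num at hs

/-- Identification of `doubleZeta` on a half plane with any holomorphic function that has the right
values for `Re s > 2`. -/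
lemma doubleZeta_eq_div {x a b : ℂ} (ha : 0 < a.re) (hb : 0 < b.re)
    (hx : ∀ p, latticePt x a b p ≠ 0) {r : ℝ} {W : ℂ → ℂ}
    (hW : DifferentiableOn ℂ W {s | r < s.re})
    (hWeq : ∀ s : ℂ, 2 < s.re → W s = pochTwo s 2 * ∑' p : ℕ × ℕ, latticePt x a b p ^ (-s))
    {s : ℂ} (hs : r < s.re) (hs' : s ∈ ({1, 2} : Set ℂ)ᶜ) :
    doubleZeta x a b s = W s / pochTwo s 2 := by
  have ha0 : a ≠ 0 := by rintro rfl; simp at ha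
  have hb0 : b ≠ 0 := by rintro rfl; simp at hb
  obtain ⟨N, c, hN, hc, hT⟩ := exists_tailBound x ha hb
  obtain ⟨V, hV, hVeq⟩ := exists_differentiable_zetaCont hT hc hN hx ha0 hb0
  have hspec : IsDoubleZeta x a b (doubleZeta x a b) := by
    refine Classical.epsilon_spec (p := IsDoubleZeta x a b) ⟨fun s => V s / pochTwo s 2, ?_, ?_⟩
    · exact hV.differentiableOn.div (differentiable_pochTwo 2).differentiableOn
        fun s hs => pochTwo_two_ne_zero hs
    · intro s hs
      show V s / pochTwo s 2 = ∑' p : ℕ × ℕ, latticePt x a b p ^ (-s)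
      rw [hVeq s hs, mul_div_cancel_left₀ _ (pochTwo_two_ne_zero (mem_compl_of_two_lt_re hs))]
  have hcount : ({1, 2} : Set ℂ).Countable := (Set.toFinite _).countable
  have hopen : IsOpen ({1, 2} : Set ℂ)ᶜ := (Set.toFinite ({1, 2} : Set ℂ)).isClosed.isOpen_compl
  have hconn : IsPreconnected ({1, 2} : Set ℂ)ᶜ :=
    (hcount.isPathConnected_compl_of_one_lt_rank (by simp)).isConnected.isPreconnected
  have hVZ : Set.EqOn (fun s => doubleZeta x a b s * pochTwo s 2) V ({1, 2} : Set ℂ)ᶜ := by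
    have h3 : (3 : ℂ) ∈ ({1, 2} : Set ℂ)ᶜ := mem_compl_of_two_lt_re (by norm_num)
    refine AnalyticOnNhd.eqOn_of_preconnected_of_eventuallyEq
      ((hspec.1.mul (differentiable_pochTwo 2).differentiableOn).analyticOnNhd hopen)
      (hV.differentiableOn.analyticOnNhd hopen) hconn h3 ?_
    have h2 : {s : ℂ | 2 < s.re} ∈ 𝓝 (3 : ℂ) :=
      (isOpen_lt continuous_const Complex.continuous_re).mem_nhds
        (show 2 < (3 : ℂ).re by norm_num)
    filter_upwards [h2] with w hw
    rw [hVeq w hw, hspec.2 w hw, mul_comm]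
    rfl
  have hVW : V s = W s := eq_of_eq_of_two_lt_re hV.differentiableOn hW
    (fun w hw => (hVeq w hw).trans (hWeq w hw).symm) hs
  rw [eq_div_iff (pochTwo_two_ne_zero hs'), ← hVW]
  exact hVZ hs'

/-- The derivative at `0` of the double zeta function, from any holomorphic function that has the
right values for `Re s > 2`. -/
lemma deriv_doubleZeta_zero {x a b : ℂ} (ha : 0 < a.re) (hb : 0 < b.re)
    (hx : ∀ p, latticePt x a b p ≠ 0) {r : ℝ} (hr : r < 0) {W : ℂ → ℂ}
    (hW : DifferentiableOn ℂ W {s | r < s.re})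
    (hWeq : ∀ s : ℂ, 2 < s.re → W s = pochTwo s 2 * ∑' p : ℕ × ℕ, latticePt x a b p ^ (-s)) :
    deriv (doubleZeta x a b) 0 = deriv (fun s => W s / pochTwo s 2) 0 := by
  refine Filter.EventuallyEq.deriv_eq ?_
  have h1 : {s : ℂ | r < s.re} ∈ 𝓝 (0 : ℂ) :=
    (isOpen_lt continuous_const Complex.continuous_re).mem_nhds (show r < (0 : ℂ).re by simpa)
  have h2 : ({1, 2} : Set ℂ)ᶜ ∈ 𝓝 (0 : ℂ) :=
    (Set.toFinite ({1, 2} : Set ℂ)).isClosed.isOpen_compl.mem_nhds (by simp)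
  filter_upwards [h1, h2] with s hs hs'
  exact doubleZeta_eq_div ha hb hx hW hWeq hs hs'

/-! ### Continuity of the reciprocal double gamma function -/

/-- The derivative at `s = 0` of the part of the double zeta function that comes from the lattice
points with `m + n ≥ N`.  The order `K = 5` makes the series converge for `Re s > -1`. -/
noncomputable def tailDeriv (x a b : ℂ) (N : ℕ) : ℂ :=
  deriv (fun s => (∑' p, tailTerm x a b 5 N s p) / pochTwo s 2) 0

lemma pochTwo_zero_two_ne_zero : pochTwo 0 2 ≠ 0 := by
  rw [pochTwo_two]; norm_num

lemma hasDerivAt_cpow_neg {y : ℂ} (hy : y ≠ 0) :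
    HasDerivAt (fun s : ℂ => y ^ (-s)) (-Complex.log y) 0 := by
  have := (hasDerivAt_neg (0 : ℂ)).const_cpow (c := y) (Or.inl hy)
  simpa using this

lemma deriv_doubleZeta_zero_eq {x a b : ℂ} (ha : 0 < a.re) (hb : 0 < b.re) {N : ℕ} {c : ℝ}
    (hT : TailBound x a b N c) (hc : 0 < c) (hN : 1 ≤ N) (hx : ∀ p, latticePt x a b p ≠ 0) :
    deriv (doubleZeta x a b) 0 =
      (∑ p ∈ headIndices N, -Complex.log (latticePt x a b p)) + tailDeriv x a b N := by
  have ha0 : a ≠ 0 := by rintro rfl; simp at ha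
  have hb0 : b ≠ 0 := by rintro rfl; simp at hb
  have hdiff : DifferentiableOn ℂ (zetaCont x a b 5 N) {s | (-1 : ℝ) < s.re} := fun s hs => by
    have hs' : (-1 : ℝ) < s.re := hs
    exact (differentiableAt_zetaCont hT hc hx ha0 hb0 (by norm_num)
      (by push_cast; linarith)).differentiableWithinAt
  rw [deriv_doubleZeta_zero ha hb hx (by norm_num : (-1 : ℝ) < 0) hdiff
    fun s hs => zetaCont_eq hT hc hN ha0 hb0 (by norm_num) hs]
  have hev : (fun s => zetaCont x a b 5 N s / pochTwo s 2) =ᶠ[𝓝 0] fun s =>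
      (∑ p ∈ headIndices N, latticePt x a b p ^ (-s)) +
        (∑' p, tailTerm x a b 5 N s p) / pochTwo s 2 := by
    have h0 : ∀ᶠ s in 𝓝 (0 : ℂ), pochTwo s 2 ≠ 0 :=
      (differentiable_pochTwo 2).continuous.continuousAt.eventually_ne pochTwo_zero_two_ne_zero
    filter_upwards [h0] with s hs
    rw [zetaCont, add_div, mul_div_cancel_left₀ _ hs]
  rw [hev.deriv_eq]
  have h1 : HasDerivAt (fun s : ℂ => ∑ p ∈ headIndices N, latticePt x a b p ^ (-s))
      (∑ p ∈ headIndices N, -Complex.log (latticePt x a b p)) 0 :=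
    HasDerivAt.fun_sum fun p _ => hasDerivAt_cpow_neg (hx p)
  have h2 : DifferentiableAt ℂ (fun s => (∑' p, tailTerm x a b 5 N s p) / pochTwo s 2) 0 :=
    (differentiableAt_tsum_tailTerm hT hc ha0 hb0 (by norm_num) (by norm_num)).1.fun_div
      (differentiable_pochTwo 2 0) pochTwo_zero_two_ne_zero
  exact (h1.fun_add h2.hasDerivAt).deriv

/-- The reciprocal double gamma function as a finite product, which carries its zeros, times a
nowhere vanishing factor. -/
lemma inv_doubleGamma_eq {x a b : ℂ} (ha : 0 < a.re) (hb : 0 < b.re) {N : ℕ} {c : ℝ}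
    (hT : TailBound x a b N c) (hc : 0 < c) (hN : 1 ≤ N) :
    (doubleGamma x a b)⁻¹ =
      (∏ p ∈ headIndices N, latticePt x a b p) * Complex.exp (-tailDeriv x a b N) := by
  by_cases hpole : ∃ m n : ℕ, x + m * a + n * b = 0
  -- at a pole both sides vanish: the zero lattice point lies in the triangle `m + n < N`
  · rw [doubleGamma, if_pos hpole, inv_zero]
    obtain ⟨m, n, hmn⟩ := hpole
    have hmn' : latticePt x a b (m, n) = 0 := hmn
    have hhead : (m, n) ∈ headIndices N := by
      rw [mem_headIndices]
      by_contra h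
      exact hT.ne_zero hc (not_lt.mp h) hmn'
    rw [Finset.prod_eq_zero hhead hmn', zero_mul]
  · have hx : ∀ p, latticePt x a b p ≠ 0 := fun p hp => hpole ⟨p.1, p.2, hp⟩
    rw [doubleGamma, if_neg hpole, deriv_doubleZeta_zero_eq ha hb hT hc hN hx, ← Complex.exp_neg,
      neg_add, Complex.exp_add, ← Finset.sum_neg_distrib, Complex.exp_sum]
    congr 1
    refine Finset.prod_congr rfl fun p _ => ?_
    rw [neg_neg, Complex.exp_log (hx p)]

/-- The derivative of `asympSum` in `s` at `s = 0`. -/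
noncomputable def asympSumDeriv (a b : ℂ) (K : ℕ) (y : ℂ) : ℂ :=
  ∑ j ∈ Finset.range K, (todd2 a b j * deriv (fun s => pochTwo s j) 0 * y ^ (2 - j : ℂ) +
    todd2 a b j * pochTwo 0 j * (y ^ (2 - j : ℂ) * Complex.log y * (-1)))

lemma hasDerivAt_asympSum (a b : ℂ) (K : ℕ) {y : ℂ} (hy : y ≠ 0) :
    HasDerivAt (fun s => asympSum a b K s y) (asympSumDeriv a b K y) 0 := by
  unfold asympSum asympSumDeriv
  refine HasDerivAt.fun_sum fun j _ => ?_
  have h1 := ((differentiable_pochTwo j 0).hasDerivAt).const_mul (todd2 a b j)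
  have h2 : HasDerivAt (fun s : ℂ => y ^ (2 - j - s)) (y ^ (2 - j : ℂ) * Complex.log y * (-1)) 0 := by
    have := ((hasDerivAt_id (0 : ℂ)).const_sub (2 - j : ℂ)).const_cpow (c := y) (Or.inl hy)
    simpa using this
  simpa using h1.fun_mul h2

lemma deriv_tailAsymp {x a b : ℂ} {N : ℕ} {c : ℝ} (hT : TailBound x a b N c) (hc : 0 < c)
    (K : ℕ) (p : ℕ × ℕ) : deriv (fun s => tailAsymp x a b K N s p) 0 =
      if N ≤ p.1 + p.2 then asympSumDeriv a b K (latticePt x a b p) else 0 := by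
  unfold tailAsymp
  split_ifs with hp
  · exact (hasDerivAt_asympSum a b K (hT.ne_zero hc hp)).deriv
  · simp

lemma deriv_tailTerm {x a b : ℂ} {N : ℕ} {c : ℝ} (hT : TailBound x a b N c) (hc : 0 < c)
    (K : ℕ) (p : ℕ × ℕ) : deriv (fun s => tailTerm x a b K N s p) 0 =
      (if N ≤ p.1 + p.2 then deriv (fun s => pochTwo s 2) 0 +
        pochTwo 0 2 * (-Complex.log (latticePt x a b p)) else 0) -
      gridDiff (fun p => if N ≤ p.1 + p.2 then asympSumDeriv a b K (latticePt x a b p) else 0) p := by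
  have h : ∀ p, HasDerivAt (fun s => tailAsymp x a b K N s p)
      (if N ≤ p.1 + p.2 then asympSumDeriv a b K (latticePt x a b p) else 0) 0 := fun p => by
    rw [← deriv_tailAsymp hT hc]
    exact (differentiable_tailAsymp hT hc K p 0).hasDerivAt
  unfold tailTerm gridDiff
  refine (HasDerivAt.fun_sub ?_ ((((h _).fun_sub (h _)).fun_sub (h _)).fun_add (h _))).deriv
  split_ifs with hp
  · have := ((differentiable_pochTwo 2 0).hasDerivAt).fun_mul
      (hasDerivAt_cpow_neg (hT.ne_zero hc hp))
    simpa using this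
  · exact hasDerivAt_const _ _

section Limit

variable {ι : Type*} {l : Filter ι} {x b : ι → ℂ} {x₀ a b₀ : ℂ}

lemma tendsto_latticePt (hx : Tendsto x l (𝓝 x₀)) (hb : Tendsto b l (𝓝 b₀)) (p : ℕ × ℕ) :
    Tendsto (fun t => latticePt (x t) a (b t) p) l (𝓝 (latticePt x₀ a b₀ p)) :=
  (hx.add tendsto_const_nhds).add (hb.const_mul _)

lemma tendsto_todd2 (hb : Tendsto b l (𝓝 b₀)) (ha : a ≠ 0) (hb0 : b₀ ≠ 0) (j : ℕ) :
    Tendsto (fun t => todd2 a (b t) j) l (𝓝 (todd2 a b₀ j)) :=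
  (continuousAt_todd2 ha hb0 j).tendsto.comp hb

lemma tendsto_cpow_const_of_re_pos {y : ι → ℂ} {y₀ : ℂ} (hy : Tendsto y l (𝓝 y₀))
    (h0 : 0 < y₀.re) (q : ℂ) : Tendsto (fun t => y t ^ q) l (𝓝 (y₀ ^ q)) :=
  hy.cpow tendsto_const_nhds (Or.inl h0)

lemma tendsto_log_of_re_pos {y : ι → ℂ} {y₀ : ℂ} (hy : Tendsto y l (𝓝 y₀))
    (h0 : 0 < y₀.re) : Tendsto (fun t => Complex.log (y t)) l (𝓝 (Complex.log y₀)) :=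
  hy.clog (Or.inl h0)

lemma tendsto_asympSum {y : ι → ℂ} {y₀ : ℂ} (hy : Tendsto y l (𝓝 y₀)) (h0 : 0 < y₀.re)
    (hb : Tendsto b l (𝓝 b₀)) (ha : a ≠ 0) (hb0 : b₀ ≠ 0) (K : ℕ) :
    Tendsto (fun t => asympSum a (b t) K 0 (y t)) l (𝓝 (asympSum a b₀ K 0 y₀)) :=
  tendsto_finsetSum _ fun j _ => ((tendsto_todd2 hb ha hb0 j).mul_const _).mul
    (tendsto_cpow_const_of_re_pos hy h0 _)

lemma tendsto_asympSumDeriv {y : ι → ℂ} {y₀ : ℂ} (hy : Tendsto y l (𝓝 y₀)) (h0 : 0 < y₀.re)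
    (hb : Tendsto b l (𝓝 b₀)) (ha : a ≠ 0) (hb0 : b₀ ≠ 0) (K : ℕ) :
    Tendsto (fun t => asympSumDeriv a (b t) K (y t)) l (𝓝 (asympSumDeriv a b₀ K y₀)) :=
  tendsto_finsetSum _ fun j _ => (((tendsto_todd2 hb ha hb0 j).mul_const _).mul
    (tendsto_cpow_const_of_re_pos hy h0 _)).add (((tendsto_todd2 hb ha hb0 j).mul_const _).mul
      (((tendsto_cpow_const_of_re_pos hy h0 _).mul (tendsto_log_of_re_pos hy h0)).mul_const _))

lemma tendsto_gridDiff {u : ι → ℕ × ℕ → ℂ} {u₀ : ℕ × ℕ → ℂ}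
    (h : ∀ p, Tendsto (fun t => u t p) l (𝓝 (u₀ p))) (p : ℕ × ℕ) :
    Tendsto (fun t => gridDiff (u t) p) l (𝓝 (gridDiff u₀ p)) :=
  (((h _).sub (h _)).sub (h _)).add (h _)

variable {N : ℕ} {c : ℝ}

lemma tendsto_tailTerm (hx : Tendsto x l (𝓝 x₀)) (hb : Tendsto b l (𝓝 b₀)) (ha : a ≠ 0)
    (hb0 : b₀ ≠ 0) (hc : 0 < c) (hT : TailBound x₀ a b₀ N c) (K : ℕ) (p : ℕ × ℕ) :
    Tendsto (fun t => tailTerm (x t) a (b t) K N 0 p) l (𝓝 (tailTerm x₀ a b₀ K N 0 p)) := by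
  unfold tailTerm
  refine Tendsto.sub ?_ (tendsto_gridDiff (fun q => ?_) p)
  · split_ifs with hp
    · exact (tendsto_cpow_const_of_re_pos (tendsto_latticePt hx hb p) (hT.re_pos hc hp) _).const_mul _
    · exact tendsto_const_nhds
  · unfold tailAsymp
    split_ifs with hq
    · exact tendsto_asympSum (tendsto_latticePt hx hb q) (hT.re_pos hc hq) hb ha hb0 K
    · exact tendsto_const_nhds

lemma tendsto_deriv_tailTerm (hx : Tendsto x l (𝓝 x₀)) (hb : Tendsto b l (𝓝 b₀)) (ha : a ≠ 0)
    (hb0 : b₀ ≠ 0) (hc : 0 < c) (hT : TailBound x₀ a b₀ N c)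
    (hTt : ∀ᶠ t in l, TailBound (x t) a (b t) N c) (K : ℕ) (p : ℕ × ℕ) :
    Tendsto (fun t => deriv (fun s => tailTerm (x t) a (b t) K N s p) 0) l
      (𝓝 (deriv (fun s => tailTerm x₀ a b₀ K N s p) 0)) := by
  rw [deriv_tailTerm hT hc]
  refine Tendsto.congr' (hTt.mono fun t ht => (deriv_tailTerm ht hc K p).symm) ?_
  refine Tendsto.sub ?_ (tendsto_gridDiff (fun q => ?_) p)
  · split_ifs with hp
    · exact ((tendsto_log_of_re_pos (tendsto_latticePt hx hb p)
        (hT.re_pos hc hp)).neg.const_mul _).const_add _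
    · exact tendsto_const_nhds
  · split_ifs with hq
    · exact tendsto_asympSumDeriv (tendsto_latticePt hx hb q) (hT.re_pos hc hq) hb ha hb0 K
    · exact tendsto_const_nhds

lemma eventually_todd2_le (hb : Tendsto b l (𝓝 b₀)) (ha : a ≠ 0) (hb0 : b₀ ≠ 0) (K : ℕ) :
    ∃ E, ∀ᶠ t in l, ∀ j < K, ‖todd2 a (b t) j‖ ≤ E := by
  obtain ⟨E, hE⟩ := exists_todd2_le a b₀ K
  refine ⟨E + 1, (eventually_all_finite (Set.finite_Iio K)).mpr fun j hj => ?_⟩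
  exact ((tendsto_todd2 hb ha hb0 j).norm.eventually_lt_const
    (lt_of_le_of_lt (hE j hj) (lt_add_one E))).mono fun t ht => ht.le

lemma tendsto_tailDeriv (hx : Tendsto x l (𝓝 x₀)) (hb : Tendsto b l (𝓝 b₀)) (ha : a ≠ 0)
    (hb0 : b₀ ≠ 0) (hc : 0 < c) (hT : TailBound x₀ a b₀ N c)
    (hTt : ∀ᶠ t in l, TailBound (x t) a (b t) N c) :
    Tendsto (fun t => tailDeriv (x t) a (b t) N) l (𝓝 (tailDeriv x₀ a b₀ N)) := by
  have hbt : ∀ᶠ t in l, b t ≠ 0 := hb.eventually_ne hb0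
  -- the terms and, by Cauchy's estimate on the circle of radius `1 / 2`, their derivatives at
  -- `0`, are dominated by multiples of `(m + n + 1) ^ (-5 / 2)`
  obtain ⟨E, hE⟩ := eventually_todd2_le hb ha hb0 5
  have hbn : ∀ᶠ t in l, ‖b t‖ ≤ max ‖a‖ (‖b₀‖ + 1) :=
    (hb.norm.eventually_lt_const (lt_add_one _)).mono fun t ht => ht.le.trans (le_max_right _ _)
  obtain ⟨C, N', hN', h⟩ := exists_norm_tailTerm_le (K := 5) (by norm_num) N (1 / 2)
    (max ‖a‖ (‖b₀‖ + 1)) E hc (σ := -1 / 2) (by norm_num)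
  have hsum := summable_add_add_one_rpow (r := 2 - (5 : ℕ) - (-1 / 2)) (by norm_num)
  have hbound : ∀ᶠ t in l, ∀ s : ℂ, ‖s‖ ≤ 1 / 2 → ∀ p : ℕ × ℕ, N' ≤ p.1 + p.2 →
      ‖tailTerm (x t) a (b t) 5 N s p‖ ≤ C * ((p.1 : ℝ) + p.2 + 1) ^ (2 - (5 : ℕ) - (-1 / 2 : ℝ)) := by
    filter_upwards [hTt, hbt, hE, hbn] with t h1 h2 h3 h4 s hs p hp
    refine h _ _ _ s h1 ha h2 hs (le_max_left _ _) h4 h3 ?_ p hp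
    have := (abs_le.mp ((Complex.abs_re_le_norm s).trans hs)).1
    linarith
  have t0 : Tendsto (fun t => ∑' p, tailTerm (x t) a (b t) 5 N 0 p) l
      (𝓝 (∑' p, tailTerm x₀ a b₀ 5 N 0 p)) := by
    refine tendsto_tsum_of_dominated_off_finite (hsum.mul_left C) (finite_setOf_add_lt N')
      (tendsto_tailTerm hx hb ha hb0 hc hT 5) ?_
    filter_upwards [hbound] with t ht p hp
    exact ht 0 (by norm_num) p (not_not.mp hp)
  have t1 : Tendsto (fun t => ∑' p, deriv (fun s => tailTerm (x t) a (b t) 5 N s p) 0) l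
      (𝓝 (∑' p, deriv (fun s => tailTerm x₀ a b₀ 5 N s p) 0)) := by
    refine tendsto_tsum_of_dominated_off_finite ((hsum.mul_left C).div_const (1 / 2))
      (finite_setOf_add_lt N') (tendsto_deriv_tailTerm hx hb ha hb0 hc hT hTt 5) ?_
    filter_upwards [hbound, hTt] with t ht hTt p hp
    refine Complex.norm_deriv_le_of_forall_mem_sphere_norm_le (by norm_num)
      (differentiable_tailTerm hTt hc 5 p).diffContOnCl fun s hs => ?_
    exact ht s (mem_sphere_zero_iff_norm.mp hs).le p (not_not.mp hp)
  have hform : ∀ x b : ℂ, b ≠ 0 → TailBound x a b N c → tailDeriv x a b N =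
      ((∑' p, deriv (fun s => tailTerm x a b 5 N s p) 0) * pochTwo 0 2 -
        (∑' p, tailTerm x a b 5 N 0 p) * deriv (fun s => pochTwo s 2) 0) / pochTwo 0 2 ^ 2 := by
    intro x b hb0 hT
    have hd := differentiableAt_tsum_tailTerm hT hc ha hb0 (K := 5) (by norm_num) (s := 0)
      (by norm_num)
    rw [tailDeriv, deriv_fun_div hd.1 (differentiable_pochTwo 2 0) pochTwo_zero_two_ne_zero,
      hd.2.tsum_eq]
  rw [hform _ _ hb0 hT]
  refine Tendsto.congr' ((hTt.and hbt).mono fun t ht => (hform _ _ ht.2 ht.1).symm) ?_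
  exact ((t1.mul_const _).sub (t0.mul_const _)).div_const _

/-- The reciprocal double gamma function `1 / Γ₂(x | a, b)` is continuous in `(x, b)`, also at its
zeros. -/
lemma tendsto_inv_doubleGamma (hx : Tendsto x l (𝓝 x₀)) (hb : Tendsto b l (𝓝 b₀)) (ha : 0 < a.re)
    (hb0 : 0 < b₀.re) :
    Tendsto (fun t => (doubleGamma (x t) a (b t))⁻¹) l (𝓝 (doubleGamma x₀ a b₀)⁻¹) := by
  have ha0 : a ≠ 0 := by rintro rfl; simp at ha
  have hb00 : b₀ ≠ 0 := by rintro rfl; simp at hb0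
  -- a cutoff `N` that serves all parameters near `(x₀, b₀)`
  set α : ℝ := min a.re (b₀.re / 2) with hα
  have hα0 : 0 < α := lt_min ha (half_pos hb0)
  have hαa : α ≤ a.re := min_le_left _ _
  have hαb : α ≤ b₀.re / 2 := min_le_right _ _
  obtain ⟨N', hN'⟩ := exists_nat_ge (1 - 2 * (x₀.re - 1) / α)
  set N := N' + 1 with hN
  have hNα : 1 - 2 * (x₀.re - 1) / α ≤ (N : ℝ) := by rw [hN]; push_cast; linarith
  have hT : TailBound x₀ a b₀ N (α / 2) :=
    tailBound_of_le_re hα0 hαa (by linarith) (by linarith) hNα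
  have hre := (Complex.continuous_re.tendsto b₀).comp hb
  have hrex := (Complex.continuous_re.tendsto x₀).comp hx
  have hev : ∀ᶠ t in l, α < (b t).re := hre.eventually_const_lt (by linarith)
  have hevx : ∀ᶠ t in l, x₀.re - 1 < (x t).re := hrex.eventually_const_lt (by linarith)
  have hTt : ∀ᶠ t in l, TailBound (x t) a (b t) N (α / 2) := by
    filter_upwards [hev, hevx] with t h1 h2
    exact tailBound_of_le_re hα0 hαa h1.le h2.le hNα
  rw [inv_doubleGamma_eq ha hb0 hT (half_pos hα0) (by omega)]
  refine Tendsto.congr' ((hTt.and hev).mono fun t ht => (inv_doubleGamma_eq ha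
    (hα0.trans ht.2) ht.1 (half_pos hα0) (by omega)).symm) ?_
  refine (tendsto_finsetProd _ fun p _ => tendsto_latticePt hx hb p).mul ?_
  exact (tendsto_tailDeriv hx hb ha0 hb00 (half_pos hα0) hT hTt).neg.cexp

end Limit

/-! ### Equal periods: the Weierstrass product of the Barnes G-function -/

/-- The entire function `(s - 1) ζ(s)`, with the value `1` at `s = 1`, where Mathlib's `riemannZeta`
has a junk value. -/
noncomputable def zetaReg : ℂ → ℂ := Function.update (fun s => (s - 1) * riemannZeta s) 1 1

lemma zetaReg_of_ne {s : ℂ} (hs : s ≠ 1) : zetaReg s = (s - 1) * riemannZeta s :=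
  Function.update_of_ne hs _ _

lemma zetaReg_one : zetaReg 1 = 1 := Function.update_self _ _ _

lemma hasDerivAt_zetaReg_one : HasDerivAt zetaReg (Real.eulerMascheroniConstant : ℂ) 1 := by
  rw [hasDerivAt_iff_tendsto_slope]
  refine tendsto_riemannZeta_sub_one_div.congr' ?_
  filter_upwards [self_mem_nhdsWithin] with s hs
  have hs1 : s ≠ 1 := hs
  have hs0 : s - 1 ≠ 0 := sub_ne_zero.mpr hs1
  rw [slope_def_field, zetaReg_one, zetaReg_of_ne hs1]
  field_simp

lemma differentiable_zetaReg : Differentiable ℂ zetaReg := by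
  intro s
  rcases eq_or_ne s 1 with rfl | hs
  · exact hasDerivAt_zetaReg_one.differentiableAt
  · have h : DifferentiableAt ℂ (fun s => (s - 1) * riemannZeta s) s :=
      (by fun_prop : DifferentiableAt ℂ (fun s : ℂ => s - 1) s).mul (differentiableAt_riemannZeta hs)
    refine h.congr_of_eventuallyEq ?_
    filter_upwards [isOpen_ne.mem_nhds hs] with w hw using zetaReg_of_ne hw

/-- The remainder after three terms in the binomial expansion of `κ (κ + u)^{-s}`, `κ = k + 1`. -/
noncomputable def stepRem (u s : ℂ) (k : ℕ) : ℂ :=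
  (k + 1) * ((k + 1 + u) ^ (-s) -
    ∑ i ∈ Finset.range 3, Ring.choose (-s) i * u ^ i * (k + 1 : ℂ) ^ (-s - i))

lemma choose_zero_one_two (s : ℂ) : Ring.choose (-s) 0 = 1 ∧ Ring.choose (-s) 1 = -s ∧
    Ring.choose (-s) 2 = s * (s + 1) / 2 := by
  have h0 : Ring.choose (-s) 0 = 1 := Ring.choose_zero_right _
  have h1 : Ring.choose (-s) 1 = -s := Ring.choose_one_right _
  refine ⟨h0, h1, ?_⟩
  rw [choose_succ, h1]
  push_cast; ring

lemma stepRem_eq (u s : ℂ) (k : ℕ) : stepRem u s k =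
    (k + 1) * ((k + 1 + u) ^ (-s) - ((k + 1 : ℂ) ^ (-s) - s * u * (k + 1 : ℂ) ^ (-s - 1) +
      s * (s + 1) / 2 * u ^ 2 * (k + 1 : ℂ) ^ (-s - 2))) := by
  obtain ⟨h0, h1, h2⟩ := choose_zero_one_two s
  simp only [stepRem, Finset.sum_range_succ, Finset.sum_range_zero, h0, h1, h2]
  push_cast
  simp only [sub_zero]
  ring

/-- As only three terms of the expansion are removed, `stepRem` is `O(k ^ (-2 - Re s))`, summable for
`Re s > -1`. -/
lemma exists_norm_stepRem_le (u : ℂ) (ρ : ℝ) {σ : ℝ} :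
    ∃ (C : ℝ) (k₀ : ℕ), ∀ s : ℂ, ‖s‖ ≤ ρ → σ ≤ s.re → ∀ k, k₀ ≤ k →
      ‖stepRem u s k‖ ≤ C * ((k : ℝ) + 1) ^ (-2 - σ) := by
  obtain ⟨k₀, hk₀⟩ := exists_nat_ge (2 * ((1 + ρ) * ‖u‖))
  refine ⟨2 * Real.exp (Real.pi * ρ) * ((1 + ρ) * ‖u‖) ^ 3, k₀, fun s hs hσ k hk => ?_⟩
  have hρ : 0 ≤ ρ := (norm_nonneg s).trans hs
  have hcast : ((k : ℂ) + 1) = (((k : ℝ) + 1 : ℝ) : ℂ) := by push_cast; rfl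
  have hpos : (0 : ℝ) < (k : ℝ) + 1 := by positivity
  have hnorm : ‖(k : ℂ) + 1‖ = (k : ℝ) + 1 := by
    rw [hcast, Complex.norm_real, Real.norm_of_nonneg hpos.le]
  have hre : 0 < ((k : ℂ) + 1).re := by rw [hcast, Complex.ofReal_re]; exact hpos
  have hk0 : (k : ℂ) + 1 ≠ 0 := by rw [hcast]; exact_mod_cast hpos.ne'
  have hkk : (k₀ : ℝ) ≤ k := by exact_mod_cast hk
  have key := norm_add_cpow_sub_le (y := (k : ℂ) + 1) (h := u) (q := -s) (M := 1 + ρ)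
    (by rw [norm_neg]; linarith) hre (by rw [hnorm]; linarith) 3
  have hcp : ‖((k : ℂ) + 1) ^ (-s)‖ ≤ Real.exp (Real.pi * ρ) * ((k : ℝ) + 1) ^ (-σ) := by
    have := norm_cpow_le_of_norm_le (q := -s) (ρ := ρ) hk0
      (by simpa using (Complex.abs_im_le_norm s).trans hs)
    rw [hnorm] at this
    refine this.trans ?_
    gcongr
    · linarith [(k.cast_nonneg : (0 : ℝ) ≤ k)]
    · simpa using hσ
  rw [stepRem, norm_mul, hnorm]
  rw [hnorm] at key
  have h3 : ((k : ℝ) + 1) ^ (-2 - σ) = ((k : ℝ) + 1) ^ (-σ) / ((k : ℝ) + 1) ^ 2 := by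
    rw [← Real.rpow_natCast _ 2, ← Real.rpow_sub hpos]
    congr 1; push_cast; ring
  calc _ ≤ ((k : ℝ) + 1) * (2 * (Real.exp (Real.pi * ρ) * ((k : ℝ) + 1) ^ (-σ)) *
        ((1 + ρ) * ‖u‖ / ((k : ℝ) + 1)) ^ 3) := by
        gcongr
        exact key.trans (by gcongr)
    _ = _ := by rw [h3]; field_simp

lemma summable_add_one_rpow {r : ℝ} (hr : r < -1) : Summable fun k : ℕ => ((k : ℝ) + 1) ^ r := by
  simpa using (summable_nat_add_iff 1).mpr (Real.summable_nat_rpow.mpr hr)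

lemma natCast_add_one_ne_zero (k : ℕ) : (k : ℂ) + 1 ≠ 0 := by exact_mod_cast k.succ_ne_zero

lemma differentiable_stepRem {u : ℂ} {k : ℕ} (hu : (k : ℂ) + 1 + u ≠ 0) :
    Differentiable ℂ fun s => stepRem u s k := by
  simp only [stepRem_eq]
  have h1 : ∀ y : ℂ, y ≠ 0 → ∀ c : ℂ, Differentiable ℂ fun s : ℂ => y ^ (-s - c) := fun y hy c =>
    Differentiable.const_cpow (by fun_prop) (Or.inl hy)
  have h2 : ∀ y : ℂ, y ≠ 0 → Differentiable ℂ fun s : ℂ => y ^ (-s) := fun y hy =>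
    Differentiable.const_cpow (by fun_prop) (Or.inl hy)
  have hk := natCast_add_one_ne_zero k
  have e1 := h2 _ hu
  have e2 := h2 _ hk
  have e3 := h1 _ hk 1
  have e4 := h1 _ hk 2
  fun_prop

lemma summable_stepRem (u : ℂ) {s : ℂ} (hs : -1 < s.re) : Summable fun k => stepRem u s k := by
  obtain ⟨C, k₀, h⟩ := exists_norm_stepRem_le u ‖s‖ (σ := s.re)
  refine Summable.of_norm_bounded_eventually_nat
    ((summable_add_one_rpow (r := -2 - s.re) (by linarith)).mul_left C) ?_
  filter_upwards [eventually_ge_atTop k₀] with k hk using h s le_rfl le_rfl k hk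

lemma differentiableAt_tsum_stepRem {u : ℂ} (hu : ∀ k : ℕ, (k : ℂ) + 1 + u ≠ 0) {s : ℂ}
    (hs : -1 < s.re) : DifferentiableAt ℂ (fun s => ∑' k, stepRem u s k) s ∧
      HasSum (fun k => deriv (fun s => stepRem u s k) s)
        (deriv (fun s => ∑' k, stepRem u s k) s) := by
  obtain ⟨σ, hσ, hσs⟩ := exists_between hs
  obtain ⟨C, k₀, h⟩ := exists_norm_stepRem_le u (‖s‖ + 1) (σ := σ)
  refine differentiableAt_tsum_and_hasSum_deriv
    (u := fun k : ℕ => C * ((k : ℝ) + 1) ^ (-2 - σ))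
    (U := {w | σ < w.re} ∩ Metric.ball 0 (‖s‖ + 1))
    ((summable_add_one_rpow (by linarith)).mul_left C) (Set.finite_Iio k₀)
    ((isOpen_lt continuous_const Complex.continuous_re).inter Metric.isOpen_ball)
    ⟨hσs, by simp⟩ (fun k => (differentiable_stepRem (hu k)).differentiableOn) ?_
  intro k hk w hw
  exact h w (mem_ball_zero_iff.mp hw.2).le hw.1.le k (by simpa using hk)

lemma summable_latticePt_cpow {x a b : ℂ} (ha : 0 < a.re) (hb : 0 < b.re) {s : ℂ} (hs : 2 < s.re) :
    Summable fun p : ℕ × ℕ => latticePt x a b p ^ (-s) := by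
  obtain ⟨N, c, hN, hc, hT⟩ := exists_tailBound x ha hb
  refine (summable_tail_cpow hT hc hs).congr_cofinite ?_
  filter_upwards [(finite_setOf_add_lt N).compl_mem_cofinite] with p hp
  rw [if_pos (not_not.mp hp)]

/-- Summation along the diagonals `m + n = k` for equal periods. -/
lemma tsum_latticePt_one_one (x : ℂ) {s : ℂ} (hs : 2 < s.re) :
    HasSum (fun k : ℕ => ((k : ℂ) + 1) * (x + k) ^ (-s))
      (∑' p : ℕ × ℕ, latticePt x 1 1 p ^ (-s)) := by
  have h := (summable_latticePt_cpow (x := x) (a := 1) (b := 1) (by simp) (by simp) hs).hasSum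
  have h' := (Finset.HasAntidiagonal.sigmaAntidiagonalEquivProd (A := ℕ)).hasSum_iff.mpr h
  have h2 := h'.sigma (fun k => hasSum_fintype _)
  convert h2 using 1
  funext k
  have hterm : ∀ p ∈ Finset.HasAntidiagonal.antidiagonal k,
      latticePt x 1 1 p ^ (-s) = (x + k) ^ (-s) := by
    intro p hp
    rw [Finset.HasAntidiagonal.mem_antidiagonal] at hp
    rw [latticePt, ← hp]
    push_cast; ring_nf
  have := (Finset.sum_coe_sort (Finset.HasAntidiagonal.antidiagonal k)
    fun p => latticePt x 1 1 p ^ (-s)).trans (Finset.sum_congr rfl hterm)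
  rw [Finset.sum_const, Finset.Nat.card_antidiagonal, nsmul_eq_mul] at this
  push_cast at this
  exact this.symm

lemma hasSum_riemannZeta {z : ℂ} (hz : 1 < z.re) :
    HasSum (fun k : ℕ => ((k : ℂ) + 1) ^ (-z)) (riemannZeta z) := by
  have hs : Summable fun k : ℕ => ((k : ℂ) + 1) ^ (-z) := by
    refine Summable.of_norm_bounded (summable_add_one_rpow (r := -z.re) (by linarith)) fun k => ?_
    have hcast : ((k : ℂ) + 1) = (((k : ℝ) + 1 : ℝ) : ℂ) := by push_cast; rfl
    rw [hcast, Complex.norm_cpow_eq_rpow_re_of_pos (by positivity), Complex.neg_re]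
  have h := hs.hasSum
  rw [zeta_eq_tsum_one_div_nat_add_one_cpow hz]
  convert h using 3 with k
  rw [Complex.cpow_neg, one_div]

/-- The analytic continuation to `Re s > -1` of `(s - 2)(s - 1) ζ₂(s, 1 + u | 1, 1)`, in terms of the
Riemann zeta function. -/
noncomputable def zetaContOne (u s : ℂ) : ℂ :=
  (s - 1) * zetaReg (s - 1) - u * s * (s - 2) * zetaReg s +
    pochTwo s 2 * ((s + 1) / 2 * u ^ 2 * zetaReg (s + 1)) + pochTwo s 2 * ∑' k, stepRem u s k

lemma zetaContOne_eq (x : ℂ) {s : ℂ} (hs : 2 < s.re) :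
    zetaContOne (x - 1) s = pochTwo s 2 * ∑' p : ℕ × ℕ, latticePt x 1 1 p ^ (-s) := by
  have z0 := hasSum_riemannZeta (z := s - 1) (by simp; linarith)
  have z1 := hasSum_riemannZeta (z := s) (by linarith)
  have z2 := hasSum_riemannZeta (z := s + 1) (by simp; linarith)
  have hr := (summable_stepRem (x - 1) (s := s) (by linarith)).hasSum
  have hsum := ((z0.sub (z1.mul_left (s * (x - 1)))).add
    (z2.mul_left (s * (s + 1) / 2 * (x - 1) ^ 2))).add hr
  have hfun : (fun k : ℕ => ((k : ℂ) + 1) ^ (-(s - 1)) - s * (x - 1) * ((k : ℂ) + 1) ^ (-s) +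
      s * (s + 1) / 2 * (x - 1) ^ 2 * ((k : ℂ) + 1) ^ (-(s + 1)) + stepRem (x - 1) s k) =
      fun k : ℕ => ((k : ℂ) + 1) * (x + k) ^ (-s) := by
    funext k
    have hk := natCast_add_one_ne_zero k
    have e0 : ((k : ℂ) + 1) ^ (-(s - 1)) = ((k : ℂ) + 1) * ((k : ℂ) + 1) ^ (-s) := by
      rw [show -(s - 1) = 1 + -s by ring, Complex.cpow_add _ _ hk, Complex.cpow_one]
    have e1 : ((k : ℂ) + 1) ^ (-s) = ((k : ℂ) + 1) * ((k : ℂ) + 1) ^ (-s - 1) := by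
      rw [show -s = 1 + (-s - 1) by ring, Complex.cpow_add _ _ hk, Complex.cpow_one]
      ring_nf
    have e2 : ((k : ℂ) + 1) ^ (-(s + 1)) = ((k : ℂ) + 1) * ((k : ℂ) + 1) ^ (-s - 2) := by
      rw [show -(s + 1) = 1 + (-s - 2) by ring, Complex.cpow_add _ _ hk, Complex.cpow_one]
    have ex : (k : ℂ) + 1 + (x - 1) = x + k := by ring
    rw [stepRem_eq, ex, e0, e2]
    linear_combination (-(s * (x - 1))) * e1
  rw [hfun] at hsum
  have heq := (tsum_latticePt_one_one x hs).unique hsum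
  have hs0 : s ≠ 0 := by rintro rfl; norm_num at hs
  have hs1 : s ≠ 1 := by rintro rfl; norm_num at hs
  have hs2 : s - 1 ≠ 1 := by
    intro h
    have : s = 2 := by linear_combination h
    rw [this] at hs; norm_num at hs
  rw [heq, zetaContOne, zetaReg_of_ne hs1, zetaReg_of_ne hs2,
    zetaReg_of_ne (by simpa using hs0 : s + 1 ≠ 1), pochTwo_two]
  ring

lemma add_one_add_ne_zero {x : ℂ} (hx : ∀ n : ℕ, x ≠ -(n : ℂ)) (k : ℕ) :
    (k : ℂ) + 1 + (x - 1) ≠ 0 := fun h => hx k (by linear_combination h)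

lemma latticePt_one_one_ne_zero {x : ℂ} (hx : ∀ n : ℕ, x ≠ -(n : ℂ)) (p : ℕ × ℕ) :
    latticePt x 1 1 p ≠ 0 := fun h => hx (p.1 + p.2) (by
      simp only [latticePt] at h; push_cast; linear_combination h)

lemma differentiableOn_zetaContOne {u : ℂ} (hu : ∀ k : ℕ, (k : ℂ) + 1 + u ≠ 0) :
    DifferentiableOn ℂ (zetaContOne u) {s | (-1 : ℝ) < s.re} := by
  intro s hs
  have h0 := (differentiableAt_tsum_stepRem hu hs).1
  have h1 := differentiable_zetaReg
  have h2 := differentiable_pochTwo 2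
  have h3 : Differentiable ℂ fun s => zetaReg (s - 1) := h1.comp (by fun_prop)
  have h4 : Differentiable ℂ fun s => zetaReg (s + 1) := h1.comp (by fun_prop)
  refine DifferentiableAt.differentiableWithinAt ?_
  unfold zetaContOne
  exact ((((by fun_prop : Differentiable ℂ fun s => (s - 1) * zetaReg (s - 1) -
    u * s * (s - 2) * zetaReg s + pochTwo s 2 * ((s + 1) / 2 * u ^ 2 * zetaReg (s + 1)))) s).fun_add
      ((h2 s).fun_mul h0))

lemma deriv_stepRem_zero {u : ℂ} {k : ℕ} (hu : (k : ℂ) + 1 + u ≠ 0) :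
    deriv (fun s => stepRem u s k) 0 = -((k : ℂ) + 1) * Complex.log (k + 1 + u) +
      (k + 1) * Complex.log (k + 1) + u - u ^ 2 / (2 * (k + 1)) := by
  have hk := natCast_add_one_ne_zero k
  simp only [stepRem_eq]
  have hs : ∀ c : ℂ, HasDerivAt (fun s : ℂ => ((k : ℂ) + 1) ^ (-s - c))
      (((k : ℂ) + 1) ^ (-0 - c) * Complex.log (k + 1) * (-1)) 0 := fun c =>
    ((hasDerivAt_neg (0 : ℂ)).sub_const c).const_cpow (Or.inl hk)
  have hid := hasDerivAt_id' (0 : ℂ)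
  have d1 := (hid.mul_const u).fun_mul (hs 1)
  have d2 := (((hid.fun_mul (hid.add_const 1)).div_const 2).mul_const (u ^ 2)).fun_mul (hs 2)
  have d := (((hasDerivAt_cpow_neg hu).fun_sub
    (((hasDerivAt_cpow_neg hk).fun_sub d1).fun_add d2))).const_mul ((k : ℂ) + 1)
  rw [d.deriv]
  have e1 : ((k : ℂ) + 1) ^ (-0 - 1 : ℂ) = ((k : ℂ) + 1)⁻¹ := by
    rw [show (-0 - 1 : ℂ) = -1 by ring, Complex.cpow_neg_one]
  have e2 : ((k : ℂ) + 1) ^ (-0 - 2 : ℂ) = (((k : ℂ) + 1) ^ 2)⁻¹ := by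
    rw [show (-0 - 2 : ℂ) = -(2 : ℕ) by push_cast; ring, Complex.cpow_neg, Complex.cpow_natCast]
  rw [e1, e2]
  field_simp
  ring

/-- The term `u / 2` comes from `ζ(0) = -1 / 2`, and `1 + γ` from the first two Laurent coefficients of
`ζ` at `1`. -/
lemma deriv_zetaContOne_div {u : ℂ} (hu : ∀ k : ℕ, (k : ℂ) + 1 + u ≠ 0) :
    deriv (fun s => zetaContOne u s / pochTwo s 2) 0 = deriv riemannZeta (-1) +
      (u + (1 + Real.eulerMascheroniConstant) * u ^ 2) / 2 +
        ∑' k, deriv (fun s => stepRem u s k) 0 := by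
  have hev : (fun s => zetaContOne u s / pochTwo s 2) =ᶠ[𝓝 0] fun s =>
      riemannZeta (s - 1) - u * (s * riemannZeta s) + (s + 1) / 2 * u ^ 2 * zetaReg (s + 1) +
        ∑' k, stepRem u s k := by
    have h1 : ∀ᶠ s in 𝓝 (0 : ℂ), s ≠ 1 := isOpen_ne.mem_nhds (by norm_num)
    have h2 : ∀ᶠ s in 𝓝 (0 : ℂ), s ≠ 2 := isOpen_ne.mem_nhds (by norm_num)
    filter_upwards [h1, h2] with s h1 h2
    have h1' : s - 1 ≠ 0 := sub_ne_zero.mpr h1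
    have h2' : s - 2 ≠ 0 := sub_ne_zero.mpr h2
    have h3 : s - 1 ≠ 1 := fun h => h2 (by linear_combination h)
    rw [zetaContOne, zetaReg_of_ne h1, zetaReg_of_ne h3, pochTwo_two]
    field_simp
    ring
  rw [hev.deriv_eq]
  have hid := hasDerivAt_id' (0 : ℂ)
  have d0 : HasDerivAt (fun s : ℂ => riemannZeta (s - 1)) (deriv riemannZeta (-1)) 0 := by
    have h := (differentiableAt_riemannZeta (s := -1) (by norm_num)).hasDerivAt
    rw [← zero_sub] at h
    rw [← zero_sub]
    exact h.comp_sub_const 0 1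
  have d1 : HasDerivAt (fun s : ℂ => u * (s * riemannZeta s)) (u * (-1 / 2)) 0 := by
    have h := (differentiableAt_riemannZeta (s := 0) (by norm_num)).hasDerivAt
    have := (hid.fun_mul h).const_mul u
    rwa [riemannZeta_zero, one_mul, zero_mul, add_zero] at this
  have d2 : HasDerivAt (fun s : ℂ => (s + 1) / 2 * u ^ 2 * zetaReg (s + 1))
      ((1 + Real.eulerMascheroniConstant) * u ^ 2 / 2) 0 := by
    have h := hasDerivAt_zetaReg_one
    rw [← zero_add (1 : ℂ)] at h
    have h' := h.comp_add_const 0 1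
    have := (((hid.add_const 1).div_const 2).mul_const (u ^ 2)).fun_mul h'
    rw [zero_add, zetaReg_one] at this
    exact this.congr_deriv (by ring)
  have d3 := differentiableAt_tsum_stepRem hu (s := 0) (by norm_num)
  rw [d3.2.tsum_eq, (((d0.fun_sub d1).fun_add d2).fun_add d3.1.hasDerivAt).deriv]
  ring

/-- The `k`-th factor of the Weierstrass product of the Barnes `G`-function at `1 + u`. -/
noncomputable def barnesFactor (u : ℂ) (k : ℕ) : ℂ :=
  (1 + u / (k + 1)) ^ (k + 1) * Complex.exp (u ^ 2 / (2 * (k + 1)) - u)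

/-- The derivatives of the remainders are logarithms of the factors of the Weierstrass product. -/
lemma exp_neg_deriv_stepRem {u : ℂ} {k : ℕ} (hu : (k : ℂ) + 1 + u ≠ 0) :
    Complex.exp (-deriv (fun s => stepRem u s k) 0) = barnesFactor u k := by
  have hk := natCast_add_one_ne_zero k
  rw [deriv_stepRem_zero hu, barnesFactor,
    show -(-((k : ℂ) + 1) * Complex.log (k + 1 + u) + (k + 1) * Complex.log (k + 1) + u -
      u ^ 2 / (2 * (k + 1))) = ((k + 1 : ℕ) : ℂ) * Complex.log (k + 1 + u) -
      ((k + 1 : ℕ) : ℂ) * Complex.log (k + 1) + (u ^ 2 / (2 * (k + 1)) - u) by push_cast; ring,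
    Complex.exp_add, Complex.exp_sub, Complex.exp_nat_mul, Complex.exp_nat_mul, Complex.exp_log hu,
    Complex.exp_log hk, ← div_pow]
  congr 2
  field_simp

lemma hasProd_barnesFactor {u : ℂ} (hu : ∀ k : ℕ, (k : ℂ) + 1 + u ≠ 0) :
    HasProd (barnesFactor u) (Complex.exp (-∑' k, deriv (fun s => stepRem u s k) 0)) := by
  have h := (differentiableAt_tsum_stepRem hu (s := 0) (by norm_num)).2
  rw [h.tsum_eq]
  have h2 := h.neg.cexp
  convert h2 using 1
  funext k
  exact (exp_neg_deriv_stepRem (hu k)).symm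

/-- The double gamma function with equal periods is the reciprocal of the Barnes `G`-function, up to
elementary factors. -/
lemma inv_doubleGamma_one_one (x : ℂ) : (doubleGamma x 1 1)⁻¹ =
    Complex.exp (-deriv riemannZeta (-1)) * barnesG x / (2 * Real.pi : ℂ) ^ ((x - 1) / 2) := by
  have h2pi : (2 * Real.pi : ℂ) ≠ 0 := by
    exact_mod_cast (mul_pos two_pos Real.pi_pos).ne'
  have hpow : (2 * Real.pi : ℂ) ^ ((x - 1) / 2) ≠ 0 := by
    rw [Ne, Complex.cpow_eq_zero_iff]; tauto
  have hG : barnesG x = (2 * Real.pi : ℂ) ^ ((x - 1) / 2) *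
      Complex.exp (-((x - 1) + (1 + Real.eulerMascheroniConstant) * (x - 1) ^ 2) / 2) *
      ∏' k : ℕ, barnesFactor (x - 1) k := rfl
  by_cases hx : ∀ n : ℕ, x ≠ -(n : ℂ)
  · have hu := add_one_add_ne_zero hx
    have hnp : ¬ ∃ m n : ℕ, x + m * 1 + n * 1 = 0 := fun ⟨m, n, h⟩ =>
      latticePt_one_one_ne_zero hx (m, n) h
    rw [doubleGamma, if_neg hnp, deriv_doubleZeta_zero (by simp) (by simp)
      (latticePt_one_one_ne_zero hx) (by norm_num : (-1 : ℝ) < 0) (differentiableOn_zetaContOne hu)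
      fun s hs => zetaContOne_eq x hs, deriv_zetaContOne_div hu, hG,
      (hasProd_barnesFactor hu).tprod_eq, ← Complex.exp_neg, neg_add, neg_add, Complex.exp_add,
      Complex.exp_add, neg_div]
    field_simp
  · push Not at hx
    obtain ⟨n, rfl⟩ := hx
    have hpole : ∃ m k : ℕ, (-(n : ℂ)) + m * 1 + k * 1 = 0 := ⟨n, 0, by simp⟩
    have hzero : ∃ k, barnesFactor (-(n : ℂ) - 1) k = 0 := by
      refine ⟨n, ?_⟩
      have hk := natCast_add_one_ne_zero n
      rw [barnesFactor, show 1 + (-(n : ℂ) - 1) / (n + 1) = 0 by field_simp; ring]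
      simp
    rw [doubleGamma, if_pos hpole, hG, tprod_of_exists_eq_zero hzero]
    simp

/-! ### The functional equation of the Barnes G-function -/

/-- A closed form for the quotients of the partial products of `G(1 + x)` and `G(x)`. -/
lemma prod_barnesFactor_mul (x : ℂ) (hx : ∀ n : ℕ, x ≠ -(n : ℂ)) (M : ℕ) :
    (∏ k ∈ Finset.range M, barnesFactor x k) * ∏ k ∈ Finset.range M, (x + k) =
      (∏ k ∈ Finset.range M, barnesFactor (x - 1) k) *
        ((M + x) ^ M * Complex.exp ((x - 1 / 2) * (harmonic M : ℚ) - M)) := by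
  induction M with
  | zero => simp
  | succ M ih =>
    have hM := natCast_add_one_ne_zero M
    have hxM : x + M ≠ 0 := fun h => hx M (by linear_combination h)
    have e1 : barnesFactor x M = ((M + 1 + x) / (M + 1)) ^ (M + 1) *
        Complex.exp (x ^ 2 / (2 * (M + 1)) - x) := by
      rw [barnesFactor]; congr 2; field_simp
    have e2 : barnesFactor (x - 1) M = ((x + M) / (M + 1)) ^ (M + 1) *
        Complex.exp ((x - 1) ^ 2 / (2 * (M + 1)) - (x - 1)) := by
      rw [barnesFactor]; congr 2; field_simp; ring
    have e3 : Complex.exp ((x - 1 / 2) * (harmonic (M + 1) : ℚ) - ((M + 1 : ℕ) : ℂ)) =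
        Complex.exp ((x - 1 / 2) * (harmonic M : ℚ) - M) * Complex.exp (x ^ 2 / (2 * (M + 1)) - x) /
        Complex.exp ((x - 1) ^ 2 / (2 * (M + 1)) - (x - 1)) := by
      rw [← Complex.exp_add, ← Complex.exp_sub, harmonic_succ]
      congr 1
      push_cast
      field_simp
      ring
    rw [Finset.prod_range_succ, Finset.prod_range_succ, Finset.prod_range_succ, e3, e2, e1]
    have hexp := Complex.exp_ne_zero ((x - 1) ^ 2 / (2 * (M + 1)) - (x - 1))
    have hc : (((M + 1 : ℕ) : ℂ) + x) = M + 1 + x := by push_cast; ring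
    have hxM' : (M : ℂ) + x = x + M := add_comm _ _
    rw [hxM'] at ih
    rw [hc, div_pow, div_pow]
    generalize Complex.exp ((x - 1 / 2) * (harmonic M : ℚ) - M) = E at ih ⊢
    field_simp
    linear_combination ((M + 1 + x) ^ (M + 1) * (x + M)) * ih

/-- Stirling's formula in the form used for the Barnes `G`-function. -/
lemma tendsto_stirling_inv :
    Tendsto (fun n : ℕ => Real.sqrt n * (n / Real.exp 1) ^ n / n.factorial) atTop
      (𝓝 (Real.sqrt (2 * Real.pi))⁻¹) := by
  have h := (Stirling.tendsto_stirlingSeq_sqrt_pi.const_mul (Real.sqrt 2)).inv₀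
    (mul_pos (by positivity) (Real.sqrt_pos.mpr Real.pi_pos)).ne'
  rw [← Real.sqrt_mul zero_le_two] at h
  refine h.congr' ?_
  filter_upwards [eventually_gt_atTop 0] with n hn
  have hn' : (0 : ℝ) < n := by exact_mod_cast hn
  have h1 : Real.sqrt n ≠ 0 := (Real.sqrt_pos.mpr hn').ne'
  have h2 : ((n : ℝ) / Real.exp 1) ^ n ≠ 0 := by positivity
  rw [Stirling.stirlingSeq, Real.sqrt_mul zero_le_two]
  have h3 : Real.sqrt 2 ≠ 0 := by positivity
  field_simp

/-- The elementary factor by which the quotient of partial products differs from Euler's sequence for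
the Gamma function. -/
lemma tendsto_barnes_quotient_factor (x : ℂ) :
    Tendsto (fun M : ℕ => (M + x) ^ (M + 1) * Complex.exp ((x - 1 / 2) * (harmonic M : ℚ) - M) /
      ((M : ℂ) ^ x * M.factorial)) atTop
      (𝓝 (Complex.exp (x + (x - 1 / 2) * Real.eulerMascheroniConstant) /
        (Real.sqrt (2 * Real.pi) : ℂ))) := by
  have t1 : Tendsto (fun M : ℕ => (1 + x / M) ^ M) atTop (𝓝 (Complex.exp x)) :=
    Complex.tendsto_one_add_div_pow_exp x
  have t2 : Tendsto (fun M : ℕ => 1 + x / M) atTop (𝓝 1) := by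
    have := (tendsto_const_div_atTop_nhds_zero_nat x).const_add 1
    simpa using this
  have t3 : Tendsto (fun n : ℕ => ((Real.sqrt n * (n / Real.exp 1) ^ n / n.factorial : ℝ) : ℂ))
      atTop (𝓝 (((Real.sqrt (2 * Real.pi))⁻¹ : ℝ) : ℂ)) :=
    (Complex.continuous_ofReal.tendsto _).comp tendsto_stirling_inv
  have t4 : Tendsto (fun n : ℕ => Complex.exp ((x - 1 / 2) * (Real.eulerMascheroniSeq' n : ℂ)))
      atTop (𝓝 (Complex.exp ((x - 1 / 2) * Real.eulerMascheroniConstant))) :=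
    (((Complex.continuous_ofReal.tendsto _).comp Real.tendsto_eulerMascheroniSeq').const_mul _).cexp
  have t := ((t1.mul t2).mul t3).mul t4
  have hlim : Complex.exp x * 1 * (((Real.sqrt (2 * Real.pi))⁻¹ : ℝ) : ℂ) *
      Complex.exp ((x - 1 / 2) * Real.eulerMascheroniConstant) =
      Complex.exp (x + (x - 1 / 2) * Real.eulerMascheroniConstant) /
        (Real.sqrt (2 * Real.pi) : ℂ) := by
    rw [Complex.exp_add, Complex.ofReal_inv]
    ring
  rw [hlim] at t
  refine t.congr' ?_
  filter_upwards [eventually_gt_atTop 0] with M hM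
  have hM0 : (M : ℂ) ≠ 0 := by exact_mod_cast hM.ne'
  have hMr : (0 : ℝ) < M := by exact_mod_cast hM
  have hfac : (M.factorial : ℂ) ≠ 0 := by exact_mod_cast M.factorial_ne_zero
  have hseq : (Real.eulerMascheroniSeq' M : ℂ) = (harmonic M : ℚ) - Complex.log M := by
    rw [Real.eulerMascheroniSeq', if_neg hM.ne', ← Complex.natCast_log]
    push_cast; rfl
  have hsqrt : ((Real.sqrt M : ℝ) : ℂ) = Complex.exp (1 / 2 * Complex.log M) := by
    rw [← Complex.natCast_log, Real.sqrt_eq_rpow, Real.rpow_def_of_pos hMr]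
    push_cast; ring_nf
  have hexp : Complex.exp ((x - 1 / 2) * (harmonic M : ℚ) - M) =
      Complex.exp ((x - 1 / 2) * ((harmonic M : ℚ) - Complex.log M)) *
      (M : ℂ) ^ x / Complex.exp 1 ^ M / Complex.exp (1 / 2 * Complex.log M) := by
    rw [Complex.cpow_def_of_ne_zero hM0, ← Complex.exp_add, ← Complex.exp_nat_mul,
      ← Complex.exp_sub, ← Complex.exp_sub]
    congr 1; ring
  have hsq : Complex.exp (1 / 2 * Complex.log M) ^ 2 = M := by
    rw [← Complex.exp_nat_mul]
    push_cast
    rw [← mul_assoc, mul_one_div_cancel two_ne_zero, one_mul, Complex.exp_log hM0]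
  have hr0 := Complex.exp_ne_zero (1 / 2 * Complex.log (M : ℂ))
  have hx0 : (M : ℂ) ^ x ≠ 0 := by rw [Ne, Complex.cpow_eq_zero_iff]; tauto
  have hsum : (M : ℂ) + x = M * (1 + x / M) := by field_simp
  rw [hexp, hsum, hseq]
  push_cast
  rw [hsqrt]
  have he := Complex.exp_ne_zero 1
  generalize 1 + x / (M : ℂ) = v
  generalize Complex.exp (1 / 2 * Complex.log (M : ℂ)) = r at hsq hr0 ⊢
  generalize Complex.exp ((x - 1 / 2) * ((harmonic M : ℚ) - Complex.log M)) = E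
  rw [mul_pow, div_pow]
  field_simp
  rw [hsq]
  ring

lemma barnesG_ne_zero {x : ℂ} (hx : ∀ n : ℕ, x ≠ -(n : ℂ)) : barnesG x ≠ 0 := by
  have h := (hasProd_barnesFactor (add_one_add_ne_zero hx)).tprod_eq
  have hG : barnesG x = (2 * Real.pi : ℂ) ^ ((x - 1) / 2) *
      Complex.exp (-((x - 1) + (1 + Real.eulerMascheroniConstant) * (x - 1) ^ 2) / 2) *
      ∏' k : ℕ, barnesFactor (x - 1) k := rfl
  rw [hG, h]
  refine mul_ne_zero (mul_ne_zero ?_ (Complex.exp_ne_zero _)) (Complex.exp_ne_zero _)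
  have h2pi : (2 * Real.pi : ℂ) ≠ 0 := by exact_mod_cast (mul_pos two_pos Real.pi_pos).ne'
  rw [Ne, Complex.cpow_eq_zero_iff]; tauto

lemma sqrt_two_pi_eq_cpow : ((Real.sqrt (2 * Real.pi) : ℝ) : ℂ) = (2 * Real.pi : ℂ) ^ (1 / 2 : ℂ) := by
  rw [Real.sqrt_eq_rpow, Complex.ofReal_cpow (by positivity)]
  push_cast; rfl

/-- The functional equation of the Barnes `G`-function. -/
lemma barnesG_add_one {x : ℂ} (hx : ∀ n : ℕ, x ≠ -(n : ℂ)) :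
    barnesG (x + 1) = Complex.Gamma x * barnesG x := by
  have hu := add_one_add_ne_zero hx
  have hu1 : ∀ k : ℕ, (k : ℂ) + 1 + x ≠ 0 := fun k h => hx (k + 1) (by
    push_cast; linear_combination h)
  have p0 := hasProd_barnesFactor hu
  have p1 := hasProd_barnesFactor hu1
  have hP0 := p0.tprod_eq
  have hP1 := p1.tprod_eq
  have hne : (∏' k, barnesFactor (x - 1) k) ≠ 0 := by rw [hP0]; exact Complex.exp_ne_zero _
  rw [← hP0] at p0
  rw [← hP1] at p1
  have tq := p1.tendsto_prod_nat.div p0.tendsto_prod_nat hne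
  have tg := (Complex.GammaSeq_tendsto_Gamma x).mul (tendsto_barnes_quotient_factor x)
  have hq : (∏' k, barnesFactor x k) / (∏' k, barnesFactor (x - 1) k) =
      Complex.Gamma x * (Complex.exp (x + (x - 1 / 2) * Real.eulerMascheroniConstant) /
        (Real.sqrt (2 * Real.pi) : ℂ)) := by
    refine tendsto_nhds_unique tq (tg.congr' ?_)
    filter_upwards [eventually_gt_atTop 0] with M hM
    have hM0 : (M : ℂ) ≠ 0 := by exact_mod_cast hM.ne'
    have hx0 : (M : ℂ) ^ x ≠ 0 := by rw [Ne, Complex.cpow_eq_zero_iff]; tauto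
    have hfac : (M.factorial : ℂ) ≠ 0 := by exact_mod_cast M.factorial_ne_zero
    have hxM : x + M ≠ 0 := fun h => hx M (by linear_combination h)
    have hprod : ∏ k ∈ Finset.range M, (x + k) ≠ 0 :=
      Finset.prod_ne_zero_iff.mpr fun k _ h => hx k (by linear_combination h)
    have hbar : ∏ k ∈ Finset.range M, barnesFactor (x - 1) k ≠ 0 := by
      refine Finset.prod_ne_zero_iff.mpr fun k _ => ?_
      rw [← exp_neg_deriv_stepRem (hu k)]
      exact Complex.exp_ne_zero _
    have hmain := prod_barnesFactor_mul x hx M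
    have hc : (M : ℂ) + x = x + M := add_comm _ _
    rw [hc] at hmain
    simp only [Complex.GammaSeq, Finset.prod_range_succ, Pi.div_apply, hc, pow_succ]
    rw [eq_div_iff hbar]
    generalize Complex.exp ((x - 1 / 2) * (harmonic M : ℚ) - M) = E at hmain ⊢
    field_simp
    linear_combination -hmain
  have h2pi : (2 * Real.pi : ℂ) ≠ 0 := by exact_mod_cast (mul_pos two_pos Real.pi_pos).ne'
  have hG : ∀ y, barnesG y = (2 * Real.pi : ℂ) ^ ((y - 1) / 2) *
      Complex.exp (-((y - 1) + (1 + Real.eulerMascheroniConstant) * (y - 1) ^ 2) / 2) *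
      ∏' k : ℕ, barnesFactor (y - 1) k := fun _ => rfl
  rw [div_eq_iff hne] at hq
  have hpow : (2 * Real.pi : ℂ) ^ (x / 2) = (2 * Real.pi : ℂ) ^ ((x - 1) / 2) *
      (2 * Real.pi : ℂ) ^ (1 / 2 : ℂ) := by
    rw [← Complex.cpow_add _ _ h2pi]; congr 1; ring
  have hs0 : (2 * Real.pi : ℂ) ^ (1 / 2 : ℂ) ≠ 0 := by rw [Ne, Complex.cpow_eq_zero_iff]; tauto
  have hexp : Complex.exp (-(x + (1 + Real.eulerMascheroniConstant) * x ^ 2) / 2) *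
      Complex.exp (x + (x - 1 / 2) * Real.eulerMascheroniConstant) =
      Complex.exp (-((x - 1) + (1 + Real.eulerMascheroniConstant) * (x - 1) ^ 2) / 2) := by
    rw [← Complex.exp_add]; congr 1; ring
  rw [hG, hG, add_sub_cancel_right, hq, ← hexp, hpow, sqrt_two_pi_eq_cpow]
  field_simp

/-! ### The functions F and Υ -/

/-- Only the factor `1 / Γ₂` needs an argument: the others are elementary functions of `τ`. -/
lemma tendsto_inv_F (w θ : ℂ) :
    Tendsto (fun τ : ℂ => (F w ((1 + τ) / 2 - θ) 1 τ)⁻¹) (𝓝 1) (𝓝 (F w (1 - θ) 1 1)⁻¹) := by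
  have hx : Tendsto (fun τ : ℂ => w + ((1 + τ) / 2 - θ)) (𝓝 1) (𝓝 (w + (1 - θ))) := by
    have hc : ContinuousAt (fun τ : ℂ => w + ((1 + τ) / 2 - θ)) 1 := by fun_prop
    have h := hc.tendsto
    rwa [show w + ((1 + 1) / 2 - θ) = w + (1 - θ) by ring] at h
  have h1 := tendsto_inv_doubleGamma hx tendsto_id (a := 1) (by simp) (by simp)
  have h2 : Tendsto (fun τ : ℂ => (Complex.exp ((1 / 2) * B22 (w + ((1 + τ) / 2 - θ)) 1 τ *
      Complex.log w))⁻¹) (𝓝 1)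
      (𝓝 (Complex.exp ((1 / 2) * B22 (w + (1 - θ)) 1 1 * Complex.log w))⁻¹) := by
    have hc : ContinuousAt (fun τ : ℂ => (Complex.exp ((1 / 2) *
        B22 (w + ((1 + τ) / 2 - θ)) 1 τ * Complex.log w))⁻¹) 1 := by
      unfold B22
      fun_prop (disch := first | exact Complex.exp_ne_zero _ | norm_num)
    have h := hc.tendsto
    rwa [show w + ((1 + 1) / 2 - θ) = w + (1 - θ) by ring] at h
  have h3 : Tendsto (fun τ : ℂ => (Complex.exp (-(3 * w ^ 2) / (4 * 1 * τ) -
      ((1 + τ) / 2 - θ) * w / (1 * τ) + w * (1 + τ) / (2 * 1 * τ)))⁻¹) (𝓝 1)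
      (𝓝 (Complex.exp (-(3 * w ^ 2) / (4 * 1 * 1) -
      (1 - θ) * w / (1 * 1) + w * (1 + 1) / (2 * 1 * 1)))⁻¹) := by
    have hc : ContinuousAt (fun τ : ℂ => (Complex.exp (-(3 * w ^ 2) / (4 * 1 * τ) -
      ((1 + τ) / 2 - θ) * w / (1 * τ) + w * (1 + τ) / (2 * 1 * τ)))⁻¹) 1 := by
      fun_prop (disch := first | exact Complex.exp_ne_zero _ | norm_num)
    have h := hc.tendsto
    rwa [show ((1 + 1) / 2 - θ) = 1 - θ by ring] at h
  have h := (h1.mul h2).mul h3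
  simpa only [F, mul_inv, id] using h

lemma inv_F_eq_Upsilon {w : ℂ} (hw : w ≠ 0) (θ : ℂ) : (F w (1 - θ) 1 1)⁻¹ = Upsilon w (-θ) := by
  have hpow : w ^ ((1 / 2) * (w + -θ) ^ 2 - 1 / 12) =
      Complex.exp ((1 / 2) * B22 (w + (1 - θ)) 1 1 * Complex.log w) := by
    rw [Complex.cpow_def_of_ne_zero hw, B22]
    congr 1; ring
  have hexp : Complex.exp (3 * w ^ 2 / 4 + -θ * w) = (Complex.exp (-(3 * w ^ 2) / (4 * 1 * 1) -
      (1 - θ) * w / (1 * 1) + w * (1 + 1) / (2 * 1 * 1)))⁻¹ := by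
    rw [← Complex.exp_neg]
    congr 1; ring
  rw [F, mul_inv, mul_inv, inv_doubleGamma_one_one, Upsilon, hpow, hexp,
    show w + -θ + 1 = w + (1 - θ) by ring,
    show (1 / 2) * (w + -θ) = (w + (1 - θ) - 1) / 2 by ring]
  generalize (2 * Real.pi : ℂ) ^ ((w + (1 - θ) - 1) / 2) = A
  generalize Complex.exp ((1 / 2) * B22 (w + (1 - θ)) 1 1 * Complex.log w) = B
  ring

lemma Upsilon_ne_zero {w θ : ℂ} (hw : w ≠ 0) (h : ∀ n : ℕ, w + θ + 1 ≠ -(n : ℂ)) :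
    Upsilon w θ ≠ 0 := by
  have h2pi : (2 * Real.pi : ℂ) ≠ 0 := by exact_mod_cast (mul_pos two_pos Real.pi_pos).ne'
  refine div_ne_zero (mul_ne_zero (mul_ne_zero (Complex.exp_ne_zero _) (barnesG_ne_zero h))
    (Complex.exp_ne_zero _)) (mul_ne_zero ?_ ?_)
  · rw [Ne, Complex.cpow_eq_zero_iff]; tauto
  · rw [Ne, Complex.cpow_eq_zero_iff]; tauto

lemma Upsilon_div_Upsilon_sub_one {w θ : ℂ} (hw : w ≠ 0) (h : ∀ n : ℕ, w + θ ≠ -(n : ℂ)) :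
    Upsilon w θ / Upsilon w (θ - 1) = Lam w θ := by
  have h2pi : (2 * Real.pi : ℂ) ≠ 0 := by exact_mod_cast (mul_pos two_pos Real.pi_pos).ne'
  have hU := Upsilon_ne_zero (θ := θ - 1) hw (by simpa [add_assoc, sub_add_cancel] using h)
  have hp : ∀ c : ℂ, (2 * Real.pi : ℂ) ^ c ≠ 0 := fun c => by
    rw [Ne, Complex.cpow_eq_zero_iff]; tauto
  have hq : ∀ c : ℂ, w ^ c ≠ 0 := fun c => by rw [Ne, Complex.cpow_eq_zero_iff]; tauto
  have e1 : (2 * Real.pi : ℂ) ^ ((1 / 2) * (w + θ)) =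
      (2 * Real.pi : ℂ) ^ ((1 / 2) * (w + (θ - 1))) * (2 * Real.pi : ℂ) ^ (1 / 2 : ℂ) := by
    rw [← Complex.cpow_add _ _ h2pi]; congr 1; ring
  have e2 : w ^ ((1 / 2) * (w + θ) ^ 2 - 1 / 12) =
      w ^ ((1 / 2) * (w + (θ - 1)) ^ 2 - 1 / 12) * w ^ (θ + w - 1 / 2) := by
    rw [← Complex.cpow_add _ _ hw]; congr 1; ring
  have e3 : Complex.exp (3 * w ^ 2 / 4 + θ * w) =
      Complex.exp (3 * w ^ 2 / 4 + (θ - 1) * w) * Complex.exp w := by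
    rw [← Complex.exp_add]; congr 1; ring
  rw [div_eq_iff hU]
  rw [Upsilon, Upsilon, Lam, barnesG_add_one h, e1, e2, e3, sqrt_two_pi_eq_cpow,
    show w + (θ - 1) + 1 = w + θ by ring]
  have h1 := hp ((1 / 2) * (w + (θ - 1)))
  have h2 := hp (1 / 2)
  have h3 := hq ((1 / 2) * (w + (θ - 1)) ^ 2 - 1 / 12)
  have h4 := hq (θ + w - 1 / 2)
  generalize (2 * Real.pi : ℂ) ^ ((1 / 2) * (w + (θ - 1))) = A1 at *
  generalize (2 * Real.pi : ℂ) ^ (1 / 2 : ℂ) = A2 at *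
  generalize w ^ ((1 / 2) * (w + (θ - 1)) ^ 2 - 1 / 12) = A3 at *
  generalize w ^ (θ + w - 1 / 2) = A4 at *
  generalize Complex.exp (3 * w ^ 2 / 4 + (θ - 1) * w) = A5
  field_simp

lemma cpow_mul_Upsilon_zero {w : ℂ} (hw : w ≠ 0) :
    w ^ (-(1 / 12) : ℂ) * Upsilon w 0 = tauFn w := by
  have hq : ∀ c : ℂ, w ^ c ≠ 0 := fun c => by rw [Ne, Complex.cpow_eq_zero_iff]; tauto
  have e : w ^ ((1 / 2) * (w + 0) ^ 2 - 1 / 12) = w ^ (w ^ 2 / 2) * w ^ (-(1 / 12) : ℂ) := by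
    rw [← Complex.cpow_add _ _ hw]; congr 1; ring
  have h := hq (-(1 / 12))
  rw [Upsilon, tauFn, e, add_zero, zero_mul, add_zero, show (1 / 2) * w = w / 2 by ring,
    ← mul_assoc ((2 * Real.pi : ℂ) ^ (w / 2)), mul_comm _ (w ^ (-(1 / 12) : ℂ)), ← mul_div_assoc,
    mul_div_mul_left _ _ h]

end QRH

theorem lemma4p2 :
    -- the limit, for both signs, every `z ∈ ℂ*`, `t ∈ ℂ* ∖ iℓ_±` with `ℓ_± = ± ℝ_{>0} z`, `θ ∈ ℂ`
    (∀ σ : ℂ, σ = 1 ∨ σ = -1 → ∀ z t θ : ℂ, z ≠ 0 → t ≠ 0 →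
      (∀ r : ℝ, 0 < r → t ≠ Complex.I * (σ * r * z)) →
      Tendsto (fun τ : ℂ => QRH.psi σ z t τ θ) (𝓝 1)
          (𝓝 (QRH.F (QRH.wVar σ z t) (1 - σ * θ) 1 1)⁻¹) ∧
        (QRH.F (QRH.wVar σ z t) (1 - σ * θ) 1 1)⁻¹ =
          QRH.Upsilon (QRH.wVar σ z t) (-(σ * θ))) ∧
    -- the difference relation, away from the poles of `Λ(w, θ | 1)`
    (∀ w θ : ℂ, w ∈ Complex.slitPlane → (∀ n : ℕ, w + θ ≠ -(n : ℂ)) →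
      QRH.Upsilon w (θ - 1) ≠ 0 ∧
        QRH.Upsilon w θ / QRH.Upsilon w (θ - 1) = QRH.Lam w θ) ∧
    -- the value at `θ = 0` is the earlier `τ`-function, up to the power `w ^ (1 / 12)`
    (∀ w : ℂ, w ∈ Complex.slitPlane →
      w ^ (-(1 / 12) : ℂ) * QRH.Upsilon w 0 = QRH.tauFn w) := by
  refine ⟨fun σ hσ z t θ hz ht _ => ?_, fun w θ hw h => ?_, fun w hw =>
    QRH.cpow_mul_Upsilon_zero (Complex.slitPlane_ne_zero hw)⟩
  · have hσ0 : σ ≠ 0 := by rcases hσ with rfl | rfl <;> norm_num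
    have hw : QRH.wVar σ z t ≠ 0 := div_ne_zero (mul_ne_zero hσ0 hz) (mul_ne_zero (mul_ne_zero
      (by exact_mod_cast (mul_pos two_pos Real.pi_pos).ne') Complex.I_ne_zero) ht)
    exact ⟨QRH.tendsto_inv_F _ _, QRH.inv_F_eq_Upsilon hw _⟩
  · have hw0 := Complex.slitPlane_ne_zero hw
    exact ⟨QRH.Upsilon_ne_zero hw0 (by simpa [add_assoc, sub_add_cancel] using h),
      QRH.Upsilon_div_Upsilon_sub_one hw0 h⟩
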